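/- Let $n\ge 3$ be an integer and let $\eta_1,\dots,\eta_n$ be independent, identically distributed real random variables with a continuous cumulative distribution function. For $2\le i\le n$ let $I_i=\mathbf 1[\eta_i>\max_{1\le j\le i-1}\eta_j]$ indicate that a new record occurs at time $i$, and let $S_n=\sum_{i=2}^n I_i$ be the number of records (not counting the first observation). Put $\lambda_n=\sum_{i=2}^n\frac1i$, and let $\mathrm{Pn}(\lambda)$ denote the Poisson distribution with mean $\lambda$. Then for every integer $k$ with $x:=(k-\lambda_n)/\sqrt{\lambda_n}\ge 1$, $$0>\frac{\mathbb{P}(S_n\ge k)}{\mathrm{Pn}(\lambda_n)([k,\infty))}-1>-\frac{2e^{13/12}\sqrt{2\pi}\,(\pi^2/6-1)}{\sqrt{(\ln n+\gamma-1)(\ln n+\gamma-\pi^2/6)}}\left(x^2+1+\frac{4x}{\sqrt{\ln n+\gamma-1}}\right),$$ where $\gamma$ is Euler's constant. -/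

import Mathlib

/-- Given observations `η 0, …, η (n - 1)` (mathematically `η₁, …, ηₙ`, shifted by one), the set of sample points at
which a new record occurs at position `i`: `i` is not the first position and `η i` is strictly
larger than all the previous observations. (The first observation, always a record, is not
counted.) -/
def recordEvent {Ω : Type*} {n : ℕ} (η : Fin n → Ω → ℝ) (i : Fin n) : Set Ω :=
  {ω | 0 < i.val ∧ ∀ j : Fin n, j < i → η j ω < η i ω}

/-- The number of records after the first observation: the sum over positions of the indicator
variables of the record events. -/
noncomputable def numRecords {Ω : Type*} {n : ℕ} (η : Fin n → Ω → ℝ) (ω : Ω) : ℕ :=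
  ∑ i : Fin n, (recordEvent η i).indicator (fun _ => 1) ω

/-- `λₙ = ∑_{i=2}^n 1/i`, a nonnegative real number. -/
noncomputable def recordMean (n : ℕ) : NNReal :=
  ∑ i ∈ Finset.Icc 2 n, 1 / (i : NNReal)

/-! By Rényi's theorem (`real_le_numRecords`) the number of records is a sum S of independent
Bernoulli variables with p_i = 1/i. Both inequalities then compare such a sum with the Poisson law
of the same mean λ.

Upper bound (`bernoulliExp_tail_lt_poissonTail`): replace p_i by (1-t)p_i and add an independent
Poisson variable of mean tλ. The probability of reaching k is P(S ≥ k) at t = 0 and the Poisson tail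
at t = 1. Up to a positive factor its t-derivative is the sum of q_i² d_i, where q_i = (1-t)p_i and
d_i is the decrease from k-2 to k-1 of the mass function with trial i omitted. For k-1 > λ this sum
is positive (`sum_sq_mul_decrease_pos`), by log-concavity and a size-bias identity.

Lower bound (`poissonTail_sub_bernoulliExp_le`): the Stein–Chen method. With g the Stein solution
for [k, ∞), P(S ≥ k) minus the Poisson tail is the sum of p_i² E[g(S_i+2) - g(S_i+1)]. The
increments of g are negative only up to k, where they carry the Poisson tail as a factor, so the
error is relative. Below k the law of S is at most e² times the Poisson law as long as k ≤ 2λ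
(`bernoulliExp_le`, `inv_mul_odds_pow_le`), and the Poisson sum of those increments is explicit. If
k > 2λ, the claimed lower bound lies below -1 and is trivial. The resulting estimate fits under the
stated constant because e² < 8, and the term 4x/√(ln n + γ - 1) is only used as being nonnegative.
-/

/-! ### Sums of independent Bernoulli variables. -/

/-- The expectation of `f` at the number of successes in independent Bernoulli trials indexed by
`I`, the trial `i` succeeding with probability `q i`. -/
noncomputable def bernoulliExp {ι : Type*} [DecidableEq ι] (I : Finset ι) (q : ι → ℝ)
    (f : ℕ → ℝ) : ℝ :=
  ∑ A ∈ I.powerset, (∏ i ∈ A, q i) * (∏ i ∈ I \ A, (1 - q i)) * f A.card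

section BernoulliExp

variable {ι : Type*} [DecidableEq ι] {I : Finset ι} {q : ι → ℝ}

theorem bernoulliExp_empty (q : ι → ℝ) (f : ℕ → ℝ) : bernoulliExp ∅ q f = f 0 := by
  simp [bernoulliExp]

theorem bernoulliExp_insert {a : ι} (ha : a ∉ I) (q : ι → ℝ) (f : ℕ → ℝ) :
    bernoulliExp (insert a I) q f =
      (1 - q a) * bernoulliExp I q f + q a * bernoulliExp I q (fun j => f (j + 1)) := by
  unfold bernoulliExp
  rw [Finset.sum_powerset_insert ha, Finset.mul_sum, Finset.mul_sum]
  congr 1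
  · refine Finset.sum_congr rfl fun A hA => ?_
    have hA' : a ∉ A := fun h => ha (Finset.mem_powerset.1 hA h)
    rw [Finset.insert_sdiff_of_notMem _ hA', Finset.prod_insert (by simp [ha])]
    ring
  · refine Finset.sum_congr rfl fun A hA => ?_
    have hA' : a ∉ A := fun h => ha (Finset.mem_powerset.1 hA h)
    rw [Finset.insert_sdiff_insert, Finset.sdiff_insert_of_notMem ha,
      Finset.prod_insert hA', Finset.card_insert_of_notMem hA']
    ring

theorem bernoulliExp_erase {i : ι} (hi : i ∈ I) (q : ι → ℝ) (f : ℕ → ℝ) :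
    bernoulliExp I q f = (1 - q i) * bernoulliExp (I.erase i) q f +
      q i * bernoulliExp (I.erase i) q (fun j => f (j + 1)) := by
  conv_lhs => rw [← Finset.insert_erase hi]
  exact bernoulliExp_insert (Finset.notMem_erase i I) q f

theorem bernoulliExp_add (I : Finset ι) (q : ι → ℝ) (f g : ℕ → ℝ) :
    bernoulliExp I q (fun j => f j + g j) = bernoulliExp I q f + bernoulliExp I q g := by
  simp only [bernoulliExp, ← Finset.sum_add_distrib, mul_add]

theorem bernoulliExp_sub (I : Finset ι) (q : ι → ℝ) (f g : ℕ → ℝ) :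
    bernoulliExp I q (fun j => f j - g j) = bernoulliExp I q f - bernoulliExp I q g := by
  simp only [bernoulliExp, ← Finset.sum_sub_distrib, mul_sub]

theorem bernoulliExp_const_mul (I : Finset ι) (q : ι → ℝ) (c : ℝ) (f : ℕ → ℝ) :
    bernoulliExp I q (fun j => c * f j) = c * bernoulliExp I q f := by
  simp only [bernoulliExp, Finset.mul_sum]
  exact Finset.sum_congr rfl fun A _ => by ring

theorem bernoulliExp_const (I : Finset ι) (q : ι → ℝ) (c : ℝ) :
    bernoulliExp I q (fun _ => c) = c := by
  induction I using Finset.induction_on with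
  | empty => exact bernoulliExp_empty _ _
  | insert a I ha ih => rw [bernoulliExp_insert ha, ih]; ring

theorem bernoulliExp_zero (I : Finset ι) (f : ℕ → ℝ) : bernoulliExp I (fun _ => 0) f = f 0 := by
  induction I using Finset.induction_on with
  | empty => exact bernoulliExp_empty _ _
  | insert a I ha ih => rw [bernoulliExp_insert ha, ih]; ring

theorem bernoulliExp_mono (hq0 : ∀ i ∈ I, 0 ≤ q i) (hq1 : ∀ i ∈ I, q i ≤ 1) {f g : ℕ → ℝ}
    (hfg : ∀ j, f j ≤ g j) : bernoulliExp I q f ≤ bernoulliExp I q g := by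
  refine Finset.sum_le_sum fun A hA => mul_le_mul_of_nonneg_left (hfg _) (mul_nonneg ?_ ?_)
  · exact Finset.prod_nonneg fun i hi => hq0 i (Finset.mem_powerset.1 hA hi)
  · exact Finset.prod_nonneg fun i hi => sub_nonneg.2 (hq1 i (Finset.sdiff_subset hi))

theorem bernoulliExp_nonneg (hq0 : ∀ i ∈ I, 0 ≤ q i) (hq1 : ∀ i ∈ I, q i ≤ 1) {f : ℕ → ℝ}
    (hf : ∀ j, 0 ≤ f j) : 0 ≤ bernoulliExp I q f := by
  simpa only [bernoulliExp_const] using bernoulliExp_mono hq0 hq1 hf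

theorem bernoulliExp_erase_le {i : ι} (hi : i ∈ I) (hq0 : ∀ i ∈ I, 0 ≤ q i)
    (hq1 : ∀ i ∈ I, q i ≤ 1) {f : ℕ → ℝ} (hf : ∀ j, 0 ≤ f j) :
    (1 - q i) * bernoulliExp (I.erase i) q f ≤ bernoulliExp I q f := by
  rw [bernoulliExp_erase hi q f]
  have : 0 ≤ q i * bernoulliExp (I.erase i) q (fun j => f (j + 1)) :=
    mul_nonneg (hq0 i hi) (bernoulliExp_nonneg (fun j hj => hq0 j (Finset.mem_of_mem_erase hj))
      (fun j hj => hq1 j (Finset.mem_of_mem_erase hj)) fun j => hf _)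
  linarith

/-- The size-bias identity `E[S g(S)] = ∑ qᵢ E[g(Sᵢ + 1)]`, where `Sᵢ` omits the trial `i`. -/
theorem bernoulliExp_mul_self (I : Finset ι) (q : ι → ℝ) (g : ℕ → ℝ) :
    bernoulliExp I q (fun j => j * g j) =
      ∑ i ∈ I, q i * bernoulliExp (I.erase i) q (fun j => g (j + 1)) := by
  induction I using Finset.induction_on generalizing g with
  | empty => simp [bernoulliExp_empty]
  | insert a I ha ih =>
    rw [bernoulliExp_insert ha, Finset.sum_insert ha, Finset.erase_insert ha]
    have h1 : (fun j : ℕ => ((j + 1 : ℕ) : ℝ) * g (j + 1)) =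
        fun j : ℕ => (j : ℝ) * g (j + 1) + g (j + 1) := by
      funext j; push_cast; ring
    rw [h1, bernoulliExp_add, ih, ih (fun j => g (j + 1))]
    have h2 : ∀ i ∈ I, q i * bernoulliExp ((insert a I).erase i) q (fun j => g (j + 1)) =
        (1 - q a) * (q i * bernoulliExp (I.erase i) q (fun j => g (j + 1))) +
          q a * (q i * bernoulliExp (I.erase i) q (fun j => g (j + 1 + 1))) := by
      intro i hi
      have hai : a ≠ i := fun h => ha (h ▸ hi)
      rw [Finset.erase_insert_of_ne hai,
        bernoulliExp_insert (fun h => ha (Finset.mem_of_mem_erase h))]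
      ring
    rw [Finset.sum_congr rfl h2, Finset.sum_add_distrib, ← Finset.mul_sum, ← Finset.mul_sum]
    ring

/-- These are the first two terms of the binomial expansion; the others are nonnegative. -/
theorem pow_succ_add_le {s w : ℝ} (hs : 0 ≤ s) (hw : 0 ≤ w) (j : ℕ) :
    s ^ (j + 1) + (j + 1) * w * s ^ j ≤ (s + w) ^ (j + 1) := by
  induction j with
  | zero => simp
  | succ j ih =>
    calc s ^ (j + 1 + 1) + ((j + 1 : ℕ) + 1) * w * s ^ (j + 1)
        ≤ (s ^ (j + 1) + (j + 1) * w * s ^ j) * (s + w) := by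
          have : 0 ≤ (j + 1) * w ^ 2 * s ^ j := by positivity
          push_cast
          rw [pow_succ s (j + 1), pow_succ s j]
          nlinarith
      _ ≤ (s + w) ^ (j + 1) * (s + w) := by gcongr
      _ = _ := by ring

/-- Poisson-type domination of the law of a sum of independent Bernoulli variables. -/
theorem bernoulliExp_le (I : Finset ι) (hq0 : ∀ i ∈ I, 0 ≤ q i) (hq1 : ∀ i ∈ I, q i < 1)
    (K : ℕ) {f : ℕ → ℝ} (hf : ∀ j, 0 ≤ f j) (hK : ∀ j, K ≤ j → f j = 0) :
    bernoulliExp I q f ≤ (∏ i ∈ I, (1 - q i)) *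
      ∑ j ∈ Finset.range K, (∑ i ∈ I, q i / (1 - q i)) ^ j / j.factorial * f j := by
  induction I using Finset.induction_on generalizing f with
  | empty =>
    rw [bernoulliExp_empty]
    rcases K with _ | K
    · simp [hK 0]
    · simp [Finset.sum_range_succ']
  | insert a I ha ih =>
    have hq0' := fun i hi => hq0 i (Finset.mem_insert_of_mem hi)
    have hq1' := fun i hi => hq1 i (Finset.mem_insert_of_mem hi)
    have ha0 := hq0 a (Finset.mem_insert_self a I)
    have ha1 := sub_pos.2 (hq1 a (Finset.mem_insert_self a I))
    rw [bernoulliExp_insert ha, Finset.prod_insert ha, Finset.sum_insert ha]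
    have e1 := ih hq0' hq1' hf hK
    have e2 := ih hq0' hq1' (f := fun j => f (j + 1)) (fun j => hf _)
      (fun j hj => hK _ (by omega))
    set P := ∏ i ∈ I, (1 - q i) with hP
    set s := ∑ i ∈ I, q i / (1 - q i) with hs
    have hP0 : 0 ≤ P := Finset.prod_nonneg fun i hi => (sub_pos.2 (hq1' i hi)).le
    have hs0 : 0 ≤ s := Finset.sum_nonneg fun i hi =>
      div_nonneg (hq0' i hi) (sub_pos.2 (hq1' i hi)).le
    set w := q a / (1 - q a) with hw
    have hw0 : 0 ≤ w := div_nonneg ha0 ha1.le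
    have hqw : q a = (1 - q a) * w := by rw [hw]; field_simp
    -- After dividing by ∏(1 - q_i), the law is given by the elementary symmetric polynomials e_j of
    -- the odds, and the claim is e_j ≤ e_1^j / j!. Adding one odds value w is the step below.
    have key : ∑ j ∈ Finset.range K, s ^ j / j.factorial * f j +
        w * ∑ j ∈ Finset.range K, s ^ j / j.factorial * f (j + 1) ≤
        ∑ j ∈ Finset.range K, (w + s) ^ j / j.factorial * f j := by
      rcases K with _ | K
      · simp
      rw [Finset.sum_range_succ (fun j => s ^ j / (j.factorial : ℝ) * f (j + 1)) K,
        hK (K + 1) le_rfl, mul_zero, add_zero, Finset.sum_range_succ', Finset.sum_range_succ',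
        Finset.mul_sum, add_right_comm, ← Finset.sum_add_distrib]
      refine add_le_add (Finset.sum_le_sum fun j _ => ?_) (by simp)
      have h1 := pow_succ_add_le hs0 hw0 j
      have h2 : s ^ (j + 1) / ((j + 1).factorial : ℝ) * f (j + 1) +
          w * (s ^ j / (j.factorial : ℝ) * f (j + 1)) =
          (s ^ (j + 1) + (j + 1) * w * s ^ j) / ((j + 1).factorial : ℝ) * f (j + 1) := by
        rw [Nat.factorial_succ]; push_cast; field_simp
      rw [h2, add_comm w s]
      have := hf (j + 1)
      gcongr
    calc (1 - q a) * bernoulliExp I q f + q a * bernoulliExp I q (fun j => f (j + 1))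
        ≤ (1 - q a) * (P * ∑ j ∈ Finset.range K, s ^ j / j.factorial * f j) +
          q a * (P * ∑ j ∈ Finset.range K, s ^ j / j.factorial * f (j + 1)) := by gcongr
      _ = (1 - q a) * P * (∑ j ∈ Finset.range K, s ^ j / j.factorial * f j +
          w * ∑ j ∈ Finset.range K, s ^ j / j.factorial * f (j + 1)) := by
          nth_rewrite 2 [hqw]; ring
      _ ≤ _ := by gcongr

end BernoulliExp

/-! ### Poisson weights and the dependence of the tail on the mean. -/

/-- The Poisson probability mass function, extended by zero to the negative integers. -/
noncomputable def poissonWeight (μ : ℝ) (j : ℤ) : ℝ :=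
  if 0 ≤ j then Real.exp (-μ) * μ ^ j.toNat / j.toNat.factorial else 0

/-- The mass that the Poisson distribution of mean `μ` gives to `[m, ∞)`. -/
noncomputable def poissonTail (μ : ℝ) (m : ℕ) : ℝ :=
  1 - ∑ j ∈ Finset.range m, poissonWeight μ j

theorem poissonWeight_natCast (μ : ℝ) (j : ℕ) :
    poissonWeight μ j = Real.exp (-μ) * μ ^ j / j.factorial := by
  simp [poissonWeight]

theorem poissonWeight_of_neg (μ : ℝ) {j : ℤ} (hj : j < 0) : poissonWeight μ j = 0 := by
  simp [poissonWeight, hj]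

theorem poissonWeight_nonneg {μ : ℝ} (hμ : 0 ≤ μ) (j : ℤ) : 0 ≤ poissonWeight μ j := by
  unfold poissonWeight
  split_ifs <;> positivity

theorem poissonWeight_pos {μ : ℝ} (hμ : 0 < μ) {j : ℤ} (hj : 0 ≤ j) : 0 < poissonWeight μ j := by
  rw [poissonWeight, if_pos hj]
  positivity

theorem succ_mul_poissonWeight (μ : ℝ) (j : ℕ) :
    (j + 1) * poissonWeight μ (j + 1 : ℕ) = μ * poissonWeight μ j := by
  rw [poissonWeight_natCast, poissonWeight_natCast, Nat.factorial_succ]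
  push_cast
  field_simp
  ring

theorem mul_poissonWeight (μ : ℝ) (j : ℤ) :
    (j : ℝ) * poissonWeight μ j = μ * poissonWeight μ (j - 1) := by
  rcases lt_trichotomy j 0 with hj | hj | hj
  · rw [poissonWeight_of_neg μ hj, poissonWeight_of_neg μ (by omega)]; simp
  · subst hj; rw [poissonWeight_of_neg μ (by omega : (0 : ℤ) - 1 < 0)]; simp
  · obtain ⟨m, rfl⟩ : ∃ m : ℕ, j = (m + 1 : ℕ) := ⟨(j - 1).toNat, by omega⟩
    have := succ_mul_poissonWeight μ m
    rw [show ((m + 1 : ℕ) : ℤ) - 1 = (m : ℤ) by push_cast; ring, ← this]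
    push_cast; rfl

/-- The recursion j w(j) = μ w(j-1) turns the inequality into i ≤ j + 1. -/
theorem poissonWeight_logConcave {μ : ℝ} (hμ : 0 ≤ μ) {i j : ℤ} (hij : i ≤ j) :
    poissonWeight μ (i - 1) * poissonWeight μ (j + 1) ≤ poissonWeight μ i * poissonWeight μ j := by
  rcases le_or_gt i 0 with hi | hi
  · rw [poissonWeight_of_neg μ (by omega : i - 1 < 0), zero_mul]
    exact mul_nonneg (poissonWeight_nonneg hμ _) (poissonWeight_nonneg hμ _)
  · have h1 := mul_poissonWeight μ i
    have h2 := mul_poissonWeight μ (j + 1)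
    rw [add_sub_cancel_right] at h2
    have hi' : (0 : ℝ) < i := by exact_mod_cast hi
    have hij' : (i : ℝ) ≤ (j + 1 : ℤ) := by exact_mod_cast (by omega : i ≤ j + 1)
    have h3 := mul_nonneg (poissonWeight_nonneg hμ (i - 1)) (poissonWeight_nonneg hμ (j + 1))
    refine le_of_mul_le_mul_left ?_ hi'
    calc (i : ℝ) * (poissonWeight μ (i - 1) * poissonWeight μ (j + 1))
        ≤ (j + 1 : ℤ) * (poissonWeight μ (i - 1) * poissonWeight μ (j + 1)) := by gcongr
      _ = i * (poissonWeight μ i * poissonWeight μ j) := by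
          linear_combination poissonWeight μ (i - 1) * h2 - poissonWeight μ j * h1

/-- Each weight has derivative w(j-1) - w(j), so the sum telescopes. Extending w by zero covers m =
0. -/
theorem hasDerivAt_poissonTail (μ : ℝ) (m : ℕ) :
    HasDerivAt (fun μ => poissonTail μ m) (poissonWeight μ (m - 1)) μ := by
  induction m with
  | zero =>
    simpa [poissonTail, poissonWeight_of_neg] using hasDerivAt_const μ (1 : ℝ)
  | succ m ih =>
    have h : (fun μ => poissonTail μ (m + 1)) =
        fun μ => poissonTail μ m - Real.exp (-μ) * μ ^ m / m.factorial := by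
      funext μ
      simp only [poissonTail, Finset.sum_range_succ, poissonWeight_natCast]; ring
    rw [h]
    have h1 : HasDerivAt (fun μ : ℝ => Real.exp (-μ)) (Real.exp (-μ) * -1) μ :=
      (hasDerivAt_neg μ).exp
    refine (ih.sub ((h1.mul (hasDerivAt_pow m μ)).div_const _)).congr_deriv ?_
    push_cast
    rw [add_sub_cancel_right, poissonWeight_natCast]
    rcases m with _ | m
    · simp [poissonWeight_of_neg]
    · push_cast
      rw [add_sub_cancel_right, poissonWeight_natCast, Nat.factorial_succ]
      push_cast
      field_simp
      ring

/-! ### Log-concavity, and the sign of the interpolation derivative. -/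

section LogConcave

variable {ι : Type*} [DecidableEq ι] {I : Finset ι} {q : ι → ℝ} {u : ℤ → ℝ}

/-- The convolution of the sequence `u` with the law of a sum of independent Bernoulli variables. -/
noncomputable def bernoulliConv (I : Finset ι) (q : ι → ℝ) (u : ℤ → ℝ) (j : ℤ) : ℝ :=
  bernoulliExp I q fun a => u (j - a)

theorem bernoulliConv_insert {a : ι} (ha : a ∉ I) (q : ι → ℝ) (u : ℤ → ℝ) (j : ℤ) :
    bernoulliConv (insert a I) q u j =
      (1 - q a) * bernoulliConv I q u j + q a * bernoulliConv I q u (j - 1) := by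
  simp only [bernoulliConv, bernoulliExp_insert ha]
  congr 4
  funext a
  congr 1
  push_cast; ring

theorem bernoulliConv_erase {i : ι} (hi : i ∈ I) (q : ι → ℝ) (u : ℤ → ℝ) (j : ℤ) :
    bernoulliConv I q u j = (1 - q i) * bernoulliConv (I.erase i) q u j +
      q i * bernoulliConv (I.erase i) q u (j - 1) := by
  conv_lhs => rw [← Finset.insert_erase hi]
  exact bernoulliConv_insert (Finset.notMem_erase i I) q u j

theorem bernoulliConv_nonneg (hq0 : ∀ i ∈ I, 0 ≤ q i) (hq1 : ∀ i ∈ I, q i ≤ 1)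
    (hu : ∀ j, 0 ≤ u j) (j : ℤ) : 0 ≤ bernoulliConv I q u j :=
  bernoulliExp_nonneg hq0 hq1 fun _ => hu _

theorem bernoulliConv_pos (hq0 : ∀ i ∈ I, 0 ≤ q i) (hq1 : ∀ i ∈ I, q i < 1)
    (hu : ∀ j, 0 ≤ u j) {j : ℤ} (hj : 0 < u j) : 0 < bernoulliConv I q u j := by
  induction I using Finset.induction_on with
  | empty => simpa [bernoulliConv, bernoulliExp_empty] using hj
  | insert a I ha ih =>
    rw [bernoulliConv_insert ha]
    have hq0' := fun i hi => hq0 i (Finset.mem_insert_of_mem hi)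
    have hq1' := fun i hi => hq1 i (Finset.mem_insert_of_mem hi)
    have h1 := mul_pos (sub_pos.2 (hq1 a (Finset.mem_insert_self a I))) (ih hq0' hq1')
    have h2 := mul_nonneg (hq0 a (Finset.mem_insert_self a I))
      (bernoulliConv_nonneg hq0' (fun i hi => (hq1' i hi).le) hu (j - 1))
    linarith

/-- Adding one Bernoulli variable gives four products. The mixed ones require v(i-2) v(j+1) ≤ v(i)
v(j-1), two applications of the inductive hypothesis; this is why log-concavity is stated for two
indices. -/
theorem bernoulliConv_logConcave (hq0 : ∀ i ∈ I, 0 ≤ q i) (hq1 : ∀ i ∈ I, q i ≤ 1)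
    (hu : ∀ i j, i ≤ j → u (i - 1) * u (j + 1) ≤ u i * u j) (i j : ℤ) (hij : i ≤ j) :
    bernoulliConv I q u (i - 1) * bernoulliConv I q u (j + 1) ≤
      bernoulliConv I q u i * bernoulliConv I q u j := by
  induction I using Finset.induction_on generalizing i j with
  | empty => simpa [bernoulliConv, bernoulliExp_empty] using hu i j hij
  | insert a I ha ih =>
    have ih := ih (fun i hi => hq0 i (Finset.mem_insert_of_mem hi))
      (fun i hi => hq1 i (Finset.mem_insert_of_mem hi))
    have ha0 := hq0 a (Finset.mem_insert_self a I)
    have ha1 := sub_nonneg.2 (hq1 a (Finset.mem_insert_self a I))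
    simp only [bernoulliConv_insert ha, add_sub_cancel_right]
    set v := bernoulliConv I q u
    have h1 := ih i j hij
    have h2 : v (i - 1 - 1) * v j ≤ v (i - 1) * v (j - 1) := by
      simpa using ih (i - 1) (j - 1) (by omega)
    have h3 : v (i - 1 - 1) * v (j + 1) ≤ v i * v (j - 1) := by
      rcases hij.lt_or_eq with h | h
      · have e1 := ih (i - 1) j (by omega)
        have e2 := ih i (j - 1) (by omega)
        rw [sub_add_cancel] at e2
        exact e1.trans e2
      · subst h
        have e1 := ih (i - 1) i (by omega)
        linarith
    have e1 := mul_le_mul_of_nonneg_left h1 (mul_nonneg ha1 ha1)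
    have e2 := mul_le_mul_of_nonneg_left h2 (mul_nonneg ha0 ha0)
    have e3 := mul_le_mul_of_nonneg_left h3 (mul_nonneg ha0 ha1)
    linarith

/-- The size-bias identity for a sum of independent Bernoulli variables and one more variable
whose mass function satisfies the Poisson recursion. -/
theorem mul_bernoulliConv {θ : ℝ} (hθ : ∀ j : ℤ, (j : ℝ) * u j = θ * u (j - 1)) (j : ℤ) :
    (j : ℝ) * bernoulliConv I q u j = θ * bernoulliConv I q u (j - 1) +
      ∑ i ∈ I, q i * bernoulliConv (I.erase i) q u (j - 1) := by
  have h1 := bernoulliExp_mul_self I q fun a => u (j - a)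
  have h2 : (fun a : ℕ => θ * u (j - 1 - a)) =
      fun a : ℕ => (j : ℝ) * u (j - a) - a * u (j - a) := by
    funext a
    have := hθ (j - a)
    rw [show j - 1 - (a : ℤ) = j - a - 1 by ring, ← this]
    push_cast; ring
  have h3 : θ * bernoulliConv I q u (j - 1) =
      (j : ℝ) * bernoulliConv I q u j - bernoulliExp I q (fun a => a * u (j - a)) := by
    simp only [bernoulliConv]
    rw [← bernoulliExp_const_mul, ← bernoulliExp_const_mul, ← bernoulliExp_sub, h2]
  have h4 : ∀ i, (bernoulliExp (I.erase i) q fun a : ℕ => u (j - (a + 1 : ℕ))) =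
      bernoulliConv (I.erase i) q u (j - 1) := by
    intro i
    unfold bernoulliConv
    congr 1
    funext a
    congr 1
    push_cast; ring
  simp only [h4] at h1
  rw [h3, h1]; ring

theorem le_of_mul_le_mul_self_of_lt {a b c : ℝ} (hb : 0 ≤ b) (h : a * c ≤ b * b)
    (hbc : b < c) : a ≤ b := by
  by_contra! hab
  nlinarith

/-- Let `dᵢ` be the decrease at `k - 2` of the mass function with the trial `i` omitted. Above the
mean the sum of the `qᵢ² dᵢ` is positive. -/
theorem sum_sq_mul_decrease_pos (hq0 : ∀ i ∈ I, 0 < q i) (hq1 : ∀ i ∈ I, q i < 1)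
    (hI : I.Nonempty) (hu0 : ∀ j, 0 ≤ u j) (hupos : ∀ j, 0 ≤ j → 0 < u j)
    (hu : ∀ i j, i ≤ j → u (i - 1) * u (j + 1) ≤ u i * u j)
    {θ : ℝ} (hθ0 : 0 ≤ θ) (hθ : ∀ j : ℤ, (j : ℝ) * u j = θ * u (j - 1)) {k : ℤ} (hk2 : 2 ≤ k)
    (hk : ∑ i ∈ I, q i + θ < k - 1) :
    0 < ∑ i ∈ I, q i ^ 2 * (bernoulliConv (I.erase i) q u (k - 2) -
      bernoulliConv (I.erase i) q u (k - 1)) := by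
  have hq0' := fun i hi => (hq0 i hi).le
  have hq1' := fun i hi => (hq1 i hi).le
  set d : ι → ℝ := fun i => bernoulliConv (I.erase i) q u (k - 2) -
      bernoulliConv (I.erase i) q u (k - 1) with hd
  have hsum : ∑ i ∈ I, q i * (1 - q i) * d i =
      (k - 1 - (∑ i ∈ I, q i + θ)) * bernoulliConv I q u (k - 1) +
        θ * (bernoulliConv I q u (k - 1) - bernoulliConv I q u (k - 2)) := by
    have h1 := mul_bernoulliConv (I := I) (q := q) hθ (k - 1)
    rw [show k - 1 - 1 = k - 2 by ring] at h1
    have h2 : ∀ i ∈ I, q i * (1 - q i) * d i =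
        q i * bernoulliConv (I.erase i) q u (k - 2) - q i * bernoulliConv I q u (k - 1) := by
      intro i hi
      rw [bernoulliConv_erase hi q u (k - 1), show k - 1 - 1 = k - 2 by ring]
      simp only [hd]; ring
    rw [Finset.sum_congr rfl h2, Finset.sum_sub_distrib, ← Finset.sum_mul]
    push_cast at h1
    linarith
  by_cases h0 : bernoulliConv I q u (k - 1) < bernoulliConv I q u (k - 2)
  -- If the full mass function decreases strictly, every d_i is positive: d_i ≤ 0 would by
  -- log-concavity make the mass with i omitted nondecreasing over k-3, k-2, k-1, hence also the
  -- full one nondecreasing from k-2 to k-1.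
  · refine Finset.sum_pos (fun i hi => mul_pos (pow_pos (hq0 i hi) 2) ?_) hI
    have hsub : ∀ l ∈ I.erase i, l ∈ I := fun l hl => Finset.mem_of_mem_erase hl
    have hlc := bernoulliConv_logConcave (fun l hl => hq0' l (hsub l hl))
      (fun l hl => hq1' l (hsub l hl)) hu (k - 2) (k - 2) le_rfl
    have hpos : 0 < bernoulliConv (I.erase i) q u (k - 2) :=
      bernoulliConv_pos (fun l hl => hq0' l (hsub l hl)) (fun l hl => hq1 l (hsub l hl)) hu0
        (hupos _ (by omega))
    rw [bernoulliConv_erase hi q u (k - 1), bernoulliConv_erase hi q u (k - 2),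
      show k - 1 - 1 = k - 2 by ring] at h0
    rw [show k - 2 + 1 = k - 1 by ring] at hlc
    by_contra! hdi
    simp only [sub_nonpos] at hdi
    set a := bernoulliConv (I.erase i) q u (k - 2 - 1)
    set b := bernoulliConv (I.erase i) q u (k - 2)
    set c := bernoulliConv (I.erase i) q u (k - 1)
    have hab : a ≤ b := by
      by_contra! hab
      nlinarith
    have h1 := sub_pos.2 (hq1 i hi)
    have h2 := hq0 i hi
    nlinarith
  -- Otherwise the size-bias identity gives positivity with weights q_i(1 - q_i), which must be
  -- changed into q_i².
  · have hS : 0 < ∑ i ∈ I, q i * (1 - q i) * d i := by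
      rw [hsum]
      have h1 : 0 < bernoulliConv I q u (k - 1) :=
        bernoulliConv_pos hq0' hq1 hu0 (hupos _ (by omega))
      have h2 := mul_pos (sub_pos.2 hk) h1
      have h3 := mul_nonneg hθ0 (sub_nonneg.2 (not_lt.1 h0))
      linarith
    by_cases hneg : ∃ i ∈ I, d i < 0
    -- The ratio of the weights, q/(1 - q), increases with q. If d_i ≥ 0 for q_i > q_l and d_i ≤ 0
    -- for q_i ≤ q_l, the new weights, normalised at q_l, only increase each term. Taking q_l
    -- largest among the negative d gives the first condition.
    · obtain ⟨l, hl, hmax⟩ := (I.filter fun i => d i < 0).exists_max_image q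
        (by obtain ⟨i, hi, h⟩ := hneg; exact ⟨i, Finset.mem_filter.2 ⟨hi, h⟩⟩)
      obtain ⟨hl, hdl⟩ := Finset.mem_filter.1 hl
      have hl1 := sub_pos.2 (hq1 l hl)
      have key : ∀ i ∈ I, q l * (q i * (1 - q i) * d i) ≤ (1 - q l) * (q i ^ 2 * d i) := by
        intro i hi
        suffices 0 ≤ q i * ((q i - q l) * d i) by nlinarith
        refine mul_nonneg (hq0' i hi) ?_
        rcases lt_or_ge (q l) (q i) with h | h
        · refine mul_nonneg (by linarith) ?_
          by_contra! hdi
          exact absurd (hmax i (Finset.mem_filter.2 ⟨hi, hdi⟩)) (not_le.2 h)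
        · refine mul_nonneg_of_nonpos_of_nonpos (by linarith) ?_
          -- For the second condition, omit both i and l: d_i and d_l are the same combination of a,
          -- b, c with parameters q_l and q_i. As q_l ≥ q_i, log-concavity carries the negative sign
          -- of d_l over to d_i.
          by_cases hil : i = l
          · rw [hil]; exact hdl.le
          have hsub : ∀ m ∈ (I.erase i).erase l, m ∈ I := fun m hm =>
            Finset.mem_of_mem_erase (Finset.mem_of_mem_erase hm)
          have hlc := bernoulliConv_logConcave (fun l hl => hq0' l (hsub l hl))
            (fun l hl => hq1' l (hsub l hl)) hu (k - 2) (k - 2) le_rfl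
          have hn := bernoulliConv_nonneg (fun l hl => hq0' l (hsub l hl))
            (fun l hl => hq1' l (hsub l hl)) hu0
          have hli : l ∈ I.erase i := Finset.mem_erase.2 ⟨Ne.symm hil, hl⟩
          have hil' : i ∈ I.erase l := Finset.mem_erase.2 ⟨hil, hi⟩
          simp only [hd] at hdl ⊢
          rw [bernoulliConv_erase hil' q u (k - 1), bernoulliConv_erase hil' q u (k - 2),
            show k - 1 - 1 = k - 2 by ring, Finset.erase_right_comm] at hdl
          rw [bernoulliConv_erase hli q u (k - 1), bernoulliConv_erase hli q u (k - 2),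
            show k - 1 - 1 = k - 2 by ring]
          rw [show k - 2 + 1 = k - 1 by ring] at hlc
          have ha := hn (k - 2 - 1)
          have hb := hn (k - 2)
          set a := bernoulliConv ((I.erase i).erase l) q u (k - 2 - 1)
          set b := bernoulliConv ((I.erase i).erase l) q u (k - 2)
          set c := bernoulliConv ((I.erase i).erase l) q u (k - 1)
          rcases lt_or_ge b c with hbc | hbc
          · have hab := le_of_mul_le_mul_self_of_lt hb hlc hbc
            have := mul_nonneg hl1.le (sub_nonneg.2 hbc.le)
            have := mul_nonneg (hq0' l hl) (sub_nonneg.2 hab)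
            linarith
          · have hab : a ≤ b := by
              by_contra! hab
              have := mul_nonneg (sub_pos.2 (hq1 i hi)).le (sub_nonneg.2 hbc)
              have := mul_nonneg (hq0' i hi) (sub_nonneg.2 hab.le)
              linarith
            have := mul_nonneg (sub_nonneg.2 h) (sub_nonneg.2 hbc)
            have := mul_nonneg (sub_nonneg.2 h) (sub_nonneg.2 hab)
            linarith
      have h1 := Finset.sum_le_sum key
      rw [← Finset.mul_sum, ← Finset.mul_sum] at h1
      exact (mul_pos_iff_of_pos_left hl1).1 ((mul_pos (hq0 l hl) hS).trans_le h1)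
    · push Not at hneg
      obtain ⟨i, hi, hi'⟩ := Finset.exists_lt_of_sum_lt
        (by simpa using hS : ∑ i ∈ I, (0 : ℝ) < ∑ i ∈ I, q i * (1 - q i) * d i)
      refine Finset.sum_pos' (fun i hi => mul_nonneg (sq_nonneg _) (hneg i hi))
        ⟨i, hi, mul_pos (pow_pos (hq0 i hi) 2) ?_⟩
      exact (mul_pos_iff_of_pos_left (mul_pos (hq0 i hi) (sub_pos.2 (hq1 i hi)))).1 hi'

end LogConcave

/-! ### Upper bound by interpolation between the Bernoulli sum and the Poisson law. -/

section UpperBound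

variable {ι : Type*} [DecidableEq ι] {I : Finset ι} {p : ι → ℝ}

/-- The expectation is affine in each success probability, with slope E[F(S_i+1) - F(S_i)], and
(1-t)p_i has derivative -p_i. -/
theorem hasDerivAt_bernoulliExp (I : Finset ι) (p : ι → ℝ) {F : ℝ → ℕ → ℝ} {F' : ℕ → ℝ} {t : ℝ}
    (hF : ∀ a, HasDerivAt (fun t => F t a) (F' a) t) :
    HasDerivAt (fun t => bernoulliExp I (fun i => (1 - t) * p i) (F t))
      (bernoulliExp I (fun i => (1 - t) * p i) F' - ∑ i ∈ I, p i *
        bernoulliExp (I.erase i) (fun i => (1 - t) * p i) (fun a => F t (a + 1) - F t a)) t := by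
  induction I using Finset.induction_on generalizing F F' with
  | empty => simpa [bernoulliExp_empty] using hF 0
  | insert a I ha ih =>
    simp only [bernoulliExp_insert ha]
    have hq : HasDerivAt (fun t : ℝ => (1 - t) * p a) (-p a) t := by
      simpa using ((hasDerivAt_id t).const_sub 1).mul_const (p a)
    have h1 := (hq.const_sub 1).mul (ih hF)
    have h2 := hq.mul (ih fun a => hF (a + 1))
    refine (h1.add h2).congr_deriv ?_
    rw [Finset.sum_insert ha, Finset.erase_insert ha]
    have h3 : ∀ i ∈ I, p i * bernoulliExp ((insert a I).erase i) (fun i => (1 - t) * p i)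
          (fun a => F t (a + 1) - F t a) =
        (1 - (1 - t) * p a) * (p i * bernoulliExp (I.erase i) (fun i => (1 - t) * p i)
          (fun a => F t (a + 1) - F t a)) +
        (1 - t) * p a * (p i * bernoulliExp (I.erase i) (fun i => (1 - t) * p i)
          (fun a => F t (a + 1 + 1) - F t (a + 1))) := by
      intro i hi
      have hai : a ≠ i := fun h => ha (h ▸ hi)
      rw [Finset.erase_insert_of_ne hai,
        bernoulliExp_insert (fun h => ha (Finset.mem_of_mem_erase h))]
      ring
    rw [Finset.sum_congr rfl h3, Finset.sum_add_distrib, ← Finset.mul_sum, ← Finset.mul_sum,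
      bernoulliExp_sub I _ (fun j => F t (j + 1)) (F t)]
    ring

theorem poissonTail_zero (m : ℕ) : poissonTail 0 m = if m = 0 then 1 else 0 := by
  rcases m with _ | m
  · simp [poissonTail]
  · simp [poissonTail, Finset.sum_range_succ', poissonWeight_natCast]

/-- Strictly more than one unit above the mean, the tail of a sum of independent Bernoulli
variables is smaller than the Poisson tail with the same mean. -/
theorem bernoulliExp_tail_lt_poissonTail (hI : I.Nonempty) (hp0 : ∀ i ∈ I, 0 < p i)
    (hp1 : ∀ i ∈ I, p i < 1) {k : ℕ} (hk2 : 2 ≤ k) (hk : ∑ i ∈ I, p i < k - 1) :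
    bernoulliExp I p (fun a => if k ≤ a then 1 else 0) < poissonTail (∑ i ∈ I, p i) k := by
  set lam := ∑ i ∈ I, p i with hlam
  have hlam0 : 0 < lam := Finset.sum_pos hp0 hI
  clear_value lam
  -- Truncated subtraction is harmless here: for a ≥ k the threshold becomes 0, where the tail is 1.
  set G : ℝ → ℝ := fun t =>
    bernoulliExp I (fun i => (1 - t) * p i) (fun a => poissonTail (t * lam) (k - a)) with hG
  have hdiff : ∀ (t : ℝ) (a : ℕ), poissonTail (t * lam) (k - (a + 1)) -
      poissonTail (t * lam) (k - a) = poissonWeight (t * lam) (k - 1 - a) := by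
    intro t a
    rcases lt_or_ge a k with h | h
    · obtain ⟨m, rfl⟩ : ∃ m, k = a + 1 + m := ⟨k - (a + 1), by omega⟩
      rw [show a + 1 + m - (a + 1) = m by omega, show a + 1 + m - a = m + 1 by omega,
        show (((a + 1 + m : ℕ) : ℤ) - 1 - a) = (m : ℕ) by push_cast; ring]
      simp [poissonTail, Finset.sum_range_succ]
    · rw [Nat.sub_eq_zero_of_le h, Nat.sub_eq_zero_of_le (by omega), sub_self,
        poissonWeight_of_neg _ (by omega)]
  have hder : ∀ t, HasDerivAt G (lam * bernoulliConv I (fun i => (1 - t) * p i)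
      (poissonWeight (t * lam)) (k - 1) - ∑ i ∈ I, p i * bernoulliConv (I.erase i)
        (fun i => (1 - t) * p i) (poissonWeight (t * lam)) (k - 1)) t := by
    intro t
    have h1 : ∀ a : ℕ, HasDerivAt (fun t => poissonTail (t * lam) (k - a))
        (lam * poissonWeight (t * lam) (k - 1 - a)) t := by
      intro a
      have h2 := (hasDerivAt_poissonTail (t * lam) (k - a)).comp t (hasDerivAt_mul_const lam)
      refine h2.congr_deriv ?_
      rw [mul_comm]
      congr 1
      rcases le_or_gt a k with h | h
      · congr 1; omega
      · rw [poissonWeight_of_neg _ (by omega), poissonWeight_of_neg _ (by omega)]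
    refine (hasDerivAt_bernoulliExp I p h1).congr_deriv ?_
    rw [bernoulliExp_const_mul]
    simp only [hdiff]
    rfl
  have hpos : ∀ t ∈ Set.Ioo (0 : ℝ) 1, 0 < deriv G t := by
    intro t ht
    rw [(hder t).deriv]
    have ht1 := sub_pos.2 ht.2
    have hθ := mul_pos ht.1 hlam0
    have key := sum_sq_mul_decrease_pos (I := I) (q := fun i => (1 - t) * p i)
      (u := poissonWeight (t * lam)) (fun i hi => mul_pos ht1 (hp0 i hi))
      (fun i hi => by nlinarith [hp0 i hi, hp1 i hi, ht.1]) hI (poissonWeight_nonneg hθ.le)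
      (fun j hj => poissonWeight_pos hθ hj)
      (fun i j hij => poissonWeight_logConcave hθ.le hij) hθ.le (mul_poissonWeight _)
      (k := k) (by exact_mod_cast hk2) (by
        rw [← Finset.mul_sum, ← hlam]; push_cast; linarith)
    -- Write λ as the sum of the p_i. Full mass minus mass without i, at k-1, is q_i d_i with q_i =
    -- (1-t)p_i; one more factor 1-t produces q_i² d_i.
    refine (mul_pos_iff_of_pos_left ht1).1 (key.trans_eq ?_)
    have hsum : ∀ c, lam * c = ∑ i ∈ I, p i * c := fun c => hlam ▸ Finset.sum_mul ..
    rw [hsum (bernoulliConv _ _ _ _), ← Finset.sum_sub_distrib, Finset.mul_sum]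
    refine Finset.sum_congr rfl fun i hi => ?_
    rw [bernoulliConv_erase hi (fun i => (1 - t) * p i) _ ((k : ℤ) - 1),
      show (k : ℤ) - 1 - 1 = k - 2 by ring]
    ring
  have hmono : StrictMonoOn G (Set.Icc 0 1) := by
    refine strictMonoOn_of_deriv_pos (convex_Icc 0 1)
      (fun t _ => (hder t).continuousAt.continuousWithinAt) ?_
    rwa [interior_Icc]
  have h01 := hmono (Set.left_mem_Icc.2 zero_le_one) (Set.right_mem_Icc.2 zero_le_one) zero_lt_one
  simpa [hG, poissonTail_zero, bernoulliExp_zero, Nat.sub_eq_zero_iff_le] using h01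

end UpperBound

/-! ### The Poisson Stein equation. -/

section PoissonTail

variable {μ : ℝ}

theorem poissonTail_succ (μ : ℝ) (m : ℕ) :
    poissonTail μ (m + 1) = poissonTail μ m - poissonWeight μ m := by
  simp only [poissonTail, Finset.sum_range_succ]; ring

theorem poissonTail_nonneg (hμ : 0 ≤ μ) (m : ℕ) : 0 ≤ poissonTail μ m := by
  have h := Real.sum_le_exp_of_nonneg hμ m
  simp only [poissonTail, poissonWeight_natCast, mul_div_assoc]
  rw [← Finset.mul_sum, sub_nonneg]
  calc Real.exp (-μ) * ∑ i ∈ Finset.range m, μ ^ i / i.factorial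
      ≤ Real.exp (-μ) * Real.exp μ := by gcongr
    _ = 1 := by rw [← Real.exp_add]; simp

theorem poissonTail_pos (hμ : 0 < μ) (m : ℕ) : 0 < poissonTail μ m := by
  have h1 := poissonTail_succ μ m
  have h2 := poissonTail_nonneg hμ.le (m + 1)
  have h3 := poissonWeight_pos hμ (Int.natCast_nonneg m)
  linarith

theorem poissonTail_le_one (hμ : 0 ≤ μ) (m : ℕ) : poissonTail μ m ≤ 1 :=
  sub_le_self _ (Finset.sum_nonneg fun _ _ => poissonWeight_nonneg hμ _)

/-- For m > 0 the difference of the two sides vanishes at μ = 0 and has derivative Q(m) ≥ 0, with Q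
the tail. This is what makes `poissonUpperRatio` decrease. -/
theorem mul_poissonTail_succ_le (hμ : 0 ≤ μ) (m : ℕ) :
    m * poissonTail μ (m + 1) ≤ μ * poissonTail μ m := by
  rcases m with _ | m
  · simpa using mul_nonneg hμ (poissonTail_nonneg hμ 0)
  set E : ℝ → ℝ := fun μ => μ * poissonTail μ (m + 1) - (m + 1 : ℕ) * poissonTail μ (m + 1 + 1)
  have hder : ∀ μ, HasDerivAt E (poissonTail μ (m + 1)) μ := by
    intro μ
    refine (((hasDerivAt_id μ).mul (hasDerivAt_poissonTail μ (m + 1))).sub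
      ((hasDerivAt_poissonTail μ (m + 1 + 1)).const_mul ((m + 1 : ℕ) : ℝ))).congr_deriv ?_
    have h := succ_mul_poissonWeight μ m
    push_cast at h ⊢
    simp only [add_sub_cancel_right, id]
    linear_combination -h
  have hmono : MonotoneOn E (Set.Ici 0) := by
    refine monotoneOn_of_deriv_nonneg (convex_Ici 0)
      (fun μ _ => (hder μ).continuousAt.continuousWithinAt)
      (fun μ _ => (hder μ).differentiableAt.differentiableWithinAt) fun μ hμ' => ?_
    rw [interior_Ici] at hμ'
    rw [(hder μ).deriv]
    exact poissonTail_nonneg (le_of_lt hμ') _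
  have h := hmono (Set.mem_Ici.2 le_rfl) (Set.mem_Ici.2 hμ) hμ
  simp only [E, poissonTail_zero] at h
  simp at h
  push_cast
  linarith

/-- The ratio of the distribution function to the mass function, normalised to satisfy the
recursion `μ A(m + 1) = m A(m) + 1`. -/
noncomputable def poissonLowerRatio (μ : ℝ) (m : ℕ) : ℝ :=
  (1 - poissonTail μ m) / (m * poissonWeight μ m)

/-- The ratio of the tail to the mass function, normalised as `poissonLowerRatio`. -/
noncomputable def poissonUpperRatio (μ : ℝ) (m : ℕ) : ℝ :=
  poissonTail μ m / (m * poissonWeight μ m)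

theorem mul_poissonLowerRatio_succ (hμ : 0 < μ) (m : ℕ) :
    μ * poissonLowerRatio μ (m + 1) = (1 - poissonTail μ (m + 1)) / poissonWeight μ m := by
  have h := succ_mul_poissonWeight μ m
  have := (poissonWeight_pos hμ (Int.natCast_nonneg m)).ne'
  have := hμ.ne'
  rw [poissonLowerRatio]
  push_cast at h ⊢
  rw [h]
  field_simp

theorem natCast_mul_poissonLowerRatio (hμ : 0 < μ) (m : ℕ) :
    m * poissonLowerRatio μ m = (1 - poissonTail μ m) / poissonWeight μ m := by
  have := (poissonWeight_pos hμ (Int.natCast_nonneg m)).ne'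
  rcases m with _ | m
  · simp [poissonTail]
  rw [poissonLowerRatio]
  field_simp

theorem mul_poissonUpperRatio_succ (hμ : 0 < μ) (m : ℕ) :
    μ * poissonUpperRatio μ (m + 1) = poissonTail μ (m + 1) / poissonWeight μ m := by
  have h := succ_mul_poissonWeight μ m
  have := (poissonWeight_pos hμ (Int.natCast_nonneg m)).ne'
  have := hμ.ne'
  rw [poissonUpperRatio]
  push_cast at h ⊢
  rw [h]
  field_simp

theorem natCast_mul_poissonUpperRatio (hμ : 0 < μ) {m : ℕ} (hm : m ≠ 0) :
    m * poissonUpperRatio μ m = poissonTail μ m / poissonWeight μ m := by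
  have := (poissonWeight_pos hμ (Int.natCast_nonneg m)).ne'
  rw [poissonUpperRatio]
  field_simp

theorem poissonLowerRatio_recursion (hμ : 0 < μ) (m : ℕ) :
    μ * poissonLowerRatio μ (m + 1) = m * poissonLowerRatio μ m + 1 := by
  rw [mul_poissonLowerRatio_succ hμ, natCast_mul_poissonLowerRatio hμ, poissonTail_succ]
  have := (poissonWeight_pos hμ (Int.natCast_nonneg m)).ne'
  field_simp
  ring

theorem poissonLowerRatio_nonneg (hμ : 0 < μ) (m : ℕ) : 0 ≤ poissonLowerRatio μ m :=
  div_nonneg (sub_nonneg.2 (poissonTail_le_one hμ.le m))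
    (mul_nonneg m.cast_nonneg (poissonWeight_nonneg hμ.le _))

theorem poissonLowerRatio_le_succ (hμ : 0 < μ) (m : ℕ) :
    poissonLowerRatio μ m ≤ poissonLowerRatio μ (m + 1) := by
  induction m with
  | zero => simpa [poissonLowerRatio] using poissonLowerRatio_nonneg hμ 1
  | succ m ih =>
    have h1 := poissonLowerRatio_recursion hμ m
    have h2 := poissonLowerRatio_recursion hμ (m + 1)
    push_cast at h2
    refine le_of_mul_le_mul_left ?_ hμ
    have := poissonLowerRatio_nonneg hμ (m + 1)
    nlinarith [mul_nonneg (Nat.cast_nonneg (α := ℝ) m) (sub_nonneg.2 ih)]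

theorem poissonUpperRatio_succ_le (hμ : 0 < μ) {m : ℕ} (hm : m ≠ 0) :
    poissonUpperRatio μ (m + 1) ≤ poissonUpperRatio μ m := by
  have hm' : (0 : ℝ) < m := by exact_mod_cast Nat.pos_of_ne_zero hm
  have hw := poissonWeight_pos hμ (Int.natCast_nonneg m)
  have h1 := mul_poissonTail_succ_le hμ.le m
  have h2 : poissonUpperRatio μ (m + 1) = poissonTail μ (m + 1) / (μ * poissonWeight μ m) := by
    rw [poissonUpperRatio, ← succ_mul_poissonWeight]
    push_cast; rfl
  rw [h2, poissonUpperRatio, div_le_div_iff₀ (by positivity) (by positivity)]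
  nlinarith [mul_le_mul_of_nonneg_right h1 hw.le]

/-- The solution of the Stein equation `μ g(a + 1) - a g(a) = 1[a ≥ k] - Q k` for the Poisson
distribution of mean `μ`, where `Q` is its tail. -/
noncomputable def poissonSteinSol (μ : ℝ) (k m : ℕ) : ℝ :=
  if m ≤ k then -(poissonTail μ k * poissonLowerRatio μ m)
  else -((1 - poissonTail μ k) * poissonUpperRatio μ m)

theorem poissonSteinSol_of_ge {k m : ℕ} (h : k ≤ m) :
    poissonSteinSol μ k m = -((1 - poissonTail μ k) * poissonUpperRatio μ m) := by
  rcases h.eq_or_lt with h | h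
  · subst h
    rw [poissonSteinSol, if_pos le_rfl, poissonLowerRatio, poissonUpperRatio]
    ring
  · rw [poissonSteinSol, if_neg (not_le.2 h)]

theorem poissonSteinSol_eq (hμ : 0 < μ) {k : ℕ} (hk : k ≠ 0) (a : ℕ) :
    μ * poissonSteinSol μ k (a + 1) - a * poissonSteinSol μ k a =
      (if k ≤ a then 1 else 0) - poissonTail μ k := by
  have hw := (poissonWeight_pos hμ (Int.natCast_nonneg a)).ne'
  split_ifs with h
  · rw [poissonSteinSol_of_ge h, poissonSteinSol_of_ge (h.trans a.le_succ)]
    have h1 := mul_poissonUpperRatio_succ hμ a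
    have h2 := natCast_mul_poissonUpperRatio hμ (m := a) (by omega)
    rw [poissonTail_succ, sub_div, div_self hw] at h1
    linear_combination (1 - poissonTail μ k) * (h2 - h1)
  · rw [poissonSteinSol, poissonSteinSol, if_pos (by omega), if_pos (by omega)]
    linear_combination -poissonTail μ k * poissonLowerRatio_recursion hμ a

/-- Up to k the solution is -Q(k) times an increasing ratio, and from k on it increases, so negative
increments occur only below k and keep the factor Q(k). -/
theorem neg_le_poissonSteinSol_sub (hμ : 0 < μ) {k : ℕ} (a : ℕ) :
    -poissonTail μ k * (if a + 2 ≤ k then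
        poissonLowerRatio μ (a + 2) - poissonLowerRatio μ (a + 1) else 0) ≤
      poissonSteinSol μ k (a + 2) - poissonSteinSol μ k (a + 1) := by
  split_ifs with h
  · rw [poissonSteinSol, poissonSteinSol, if_pos h, if_pos (by omega)]
    linarith
  · rw [poissonSteinSol_of_ge (by omega), poissonSteinSol_of_ge (by omega)]
    have := mul_nonneg (sub_nonneg.2 (poissonTail_le_one hμ.le k))
      (sub_nonneg.2 (poissonUpperRatio_succ_le hμ (m := a + 1) (by omega)))
    linarith

theorem sum_range_max_sub_le (μ : ℝ) (K : ℕ) :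
    ∑ j ∈ Finset.range K, max ((j : ℝ) + 1 - μ) 0 ≤ max ((K : ℝ) + 1 - μ) 0 ^ 2 / 2 := by
  induction K with
  | zero => simp only [Finset.range_zero, Finset.sum_empty]; positivity
  | succ K ih =>
    rw [Finset.sum_range_succ]
    push_cast
    rcases le_total ((K : ℝ) + 1 - μ) 0 with h | h
    · rw [max_eq_right h] at ih ⊢
      have : 0 ≤ max ((K : ℝ) + 1 + 1 - μ) 0 ^ 2 / 2 := by positivity
      linarith
    · rw [max_eq_left h] at ih ⊢
      rw [max_eq_left (by linarith)]
      nlinarith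

/-- Two uses of the recursion give the exact summand (j+1-μ) P(X ≤ j) + μ w(j). Bound the
probability by 1 where j+1 > μ, drop the first term elsewhere, and use that the weights sum to at
most 1. -/
theorem sum_poissonWeight_mul_ratio_sub_le (hμ : 0 < μ) (K : ℕ) :
    μ ^ 2 * ∑ j ∈ Finset.range K, poissonWeight μ j *
        (poissonLowerRatio μ (j + 2) - poissonLowerRatio μ (j + 1)) ≤
      max ((K : ℝ) + 1 - μ) 0 ^ 2 / 2 + μ := by
  have h1 : ∀ j : ℕ, μ ^ 2 * (poissonWeight μ j *
      (poissonLowerRatio μ (j + 2) - poissonLowerRatio μ (j + 1))) ≤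
      max ((j : ℝ) + 1 - μ) 0 + μ * poissonWeight μ j := by
    intro j
    have hw := (poissonWeight_pos hμ (Int.natCast_nonneg j)).ne'
    have e1 := poissonLowerRatio_recursion hμ (j + 1)
    have e2 := mul_poissonLowerRatio_succ hμ j
    rw [eq_div_iff hw] at e2
    push_cast at e1
    have e3 : μ ^ 2 * (poissonWeight μ j *
        (poissonLowerRatio μ (j + 2) - poissonLowerRatio μ (j + 1))) =
        ((j : ℝ) + 1 - μ) * (1 - poissonTail μ (j + 1)) + μ * poissonWeight μ j := by
      linear_combination μ * poissonWeight μ j * e1 + ((j : ℝ) + 1 - μ) * e2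
    have c0 := sub_nonneg.2 (poissonTail_le_one hμ.le (j + 1))
    have c1 := poissonTail_nonneg hμ.le (j + 1)
    rw [e3]
    gcongr
    calc ((j : ℝ) + 1 - μ) * (1 - poissonTail μ (j + 1))
        ≤ max ((j : ℝ) + 1 - μ) 0 * (1 - poissonTail μ (j + 1)) := by
          gcongr; exact le_max_left _ _
      _ ≤ max ((j : ℝ) + 1 - μ) 0 :=
          mul_le_of_le_one_right (le_max_right _ _) (by linarith)
  rw [Finset.mul_sum]
  refine (Finset.sum_le_sum fun j _ => h1 j).trans ?_
  rw [Finset.sum_add_distrib, ← Finset.mul_sum]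
  refine add_le_add (sum_range_max_sub_le μ K) (mul_le_of_le_one_right hμ.le ?_)
  have := poissonTail_nonneg hμ.le K
  rw [poissonTail] at this
  linarith

end PoissonTail

/-! ### Lower bound by the Stein–Chen method. -/

section LowerBound

variable {ι : Type*} [DecidableEq ι] {I : Finset ι} {p : ι → ℝ}

theorem poissonTail_sub_bernoulliExp_le (hI : I.Nonempty) (hp0 : ∀ i ∈ I, 0 < p i)
    (hp1 : ∀ i ∈ I, p i < 1) {μ : ℝ} (hμ : ∑ i ∈ I, p i = μ) {k : ℕ} (hk : k ≠ 0) {C : ℝ}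
    (hC : ∀ j < k - 1, (∏ i ∈ I, (1 - p i)) * ((∑ i ∈ I, p i / (1 - p i)) ^ j / j.factorial) ≤
      C * poissonWeight μ j) (hC0 : 0 ≤ C) :
    poissonTail μ k - bernoulliExp I p (fun a => if k ≤ a then 1 else 0) ≤
      poissonTail μ k * ((∑ i ∈ I, p i ^ 2 / (1 - p i)) *
        (C * ((max ((k : ℝ) - μ) 0 ^ 2 / 2 + μ) / μ ^ 2))) := by
  have hμ0 : 0 < μ := hμ ▸ Finset.sum_pos hp0 hI
  have hp0' := fun i hi => (hp0 i hi).le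
  have hp1' := fun i hi => (hp1 i hi).le
  set g := poissonSteinSol μ k with hg
  set R : ℕ → ℝ := fun a => if a + 2 ≤ k then
        poissonLowerRatio μ (a + 2) - poissonLowerRatio μ (a + 1) else 0 with hR
  have hR0 : ∀ a, 0 ≤ R a := by
    intro a
    simp only [hR]
    split_ifs
    · exact sub_nonneg.2 (poissonLowerRatio_le_succ hμ0 _)
    · exact le_rfl
  have hQ := poissonTail_nonneg hμ0.le k
  have hstein : bernoulliExp I p (fun a => if k ≤ a then 1 else 0) - poissonTail μ k =
      -- The size-bias identity turns E[S g(S)] into the sum of p_i E[g(S_i+1)]; conditioning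
      -- E[g(S+1)] on trial i supplies the second factor p_i.
      ∑ i ∈ I, p i ^ 2 * bernoulliExp (I.erase i) p (fun a => g (a + 2) - g (a + 1)) := by
    have h1 : bernoulliExp I p (fun a => if k ≤ a then 1 else 0) - poissonTail μ k =
        bernoulliExp I p (fun a => μ * g (a + 1) - a * g a) := by
      simp only [hg, poissonSteinSol_eq hμ0 hk]
      rw [bernoulliExp_sub I p (fun a => if k ≤ a then 1 else 0), bernoulliExp_const]
    rw [h1, bernoulliExp_sub, bernoulliExp_const_mul, bernoulliExp_mul_self, ← hμ, Finset.sum_mul,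
      ← Finset.sum_sub_distrib]
    refine Finset.sum_congr rfl fun i hi => ?_
    rw [bernoulliExp_erase hi, bernoulliExp_sub]
    ring
  have hW : bernoulliExp I p R ≤ C * ((max ((k : ℝ) - μ) 0 ^ 2 / 2 + μ) / μ ^ 2) := by
    refine (bernoulliExp_le I hp0' hp1 (k - 1) hR0 fun j hj => if_neg (by omega)).trans ?_
    have h1 := sum_poissonWeight_mul_ratio_sub_le hμ0 (k - 1)
    rw [show ((k - 1 : ℕ) : ℝ) + 1 = k by
      rw [Nat.cast_sub (Nat.pos_of_ne_zero hk)]; simp] at h1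
    calc _ ≤ ∑ j ∈ Finset.range (k - 1), C * (poissonWeight μ j *
          (poissonLowerRatio μ (j + 2) - poissonLowerRatio μ (j + 1))) := by
          rw [Finset.mul_sum]
          refine Finset.sum_le_sum fun j hj => ?_
          have hj := Finset.mem_range.1 hj
          have hRj : R j = poissonLowerRatio μ (j + 2) - poissonLowerRatio μ (j + 1) :=
            if_pos (by omega)
          rw [← hRj, ← mul_assoc, ← mul_assoc]
          exact mul_le_mul_of_nonneg_right (hC j hj) (hR0 j)
      _ ≤ _ := by
          rw [← Finset.mul_sum]
          refine mul_le_mul_of_nonneg_left ?_ hC0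
          rw [le_div_iff₀ (by positivity)]
          linarith
  have hterm : ∀ i ∈ I, -(poissonTail μ k * (p i ^ 2 / (1 - p i) * bernoulliExp I p R)) ≤
      p i ^ 2 * bernoulliExp (I.erase i) p (fun a => g (a + 2) - g (a + 1)) := by
    intro i hi
    have h1 := sub_pos.2 (hp1 i hi)
    have h2 : -poissonTail μ k * bernoulliExp (I.erase i) p R ≤
        bernoulliExp (I.erase i) p (fun a => g (a + 2) - g (a + 1)) := by
      rw [← bernoulliExp_const_mul]
      exact bernoulliExp_mono (fun j hj => hp0' j (Finset.mem_of_mem_erase hj))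
        (fun j hj => hp1' j (Finset.mem_of_mem_erase hj)) (neg_le_poissonSteinSol_sub hμ0)
    -- Restoring trial i costs 1/(1 - p_i), since S = S_i when it fails. All terms then share one
    -- expectation.
    have h3 : bernoulliExp (I.erase i) p R ≤ bernoulliExp I p R / (1 - p i) := by
      rw [le_div_iff₀ h1, mul_comm]
      exact bernoulliExp_erase_le hi hp0' hp1' hR0
    calc -(poissonTail μ k * (p i ^ 2 / (1 - p i) * bernoulliExp I p R))
        = -(p i ^ 2 * (poissonTail μ k * (bernoulliExp I p R / (1 - p i)))) := by ring
      _ ≤ -(p i ^ 2 * (poissonTail μ k * bernoulliExp (I.erase i) p R)) := by gcongr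
      _ = p i ^ 2 * (-poissonTail μ k * bernoulliExp (I.erase i) p R) := by ring
      _ ≤ _ := by gcongr
  have hsum := Finset.sum_le_sum hterm
  rw [← hstein, Finset.sum_neg_distrib, ← Finset.mul_sum, ← Finset.sum_mul] at hsum
  have hS : 0 ≤ ∑ i ∈ I, p i ^ 2 / (1 - p i) := Finset.sum_nonneg fun i hi =>
    div_nonneg (sq_nonneg _) (sub_pos.2 (hp1 i hi)).le
  calc _ ≤ poissonTail μ k * ((∑ i ∈ I, p i ^ 2 / (1 - p i)) * bernoulliExp I p R) := by linarith
    _ ≤ _ := by gcongr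

end LowerBound

/-! ### Rényi's theorem on records. -/

section Renyi

open MeasureTheory

theorem nullSingletonClass_of_continuous_cdf (ν : Measure ℝ) [IsProbabilityMeasure ν]
    (h : Continuous fun t : ℝ => ProbabilityTheory.cdf ν t) : NullSingletonClass ν := by
  refine ⟨fun a => ?_⟩
  rw [← ProbabilityTheory.measure_cdf ν, StieltjesFunction.measure_singleton,
    leftLim_eq_of_tendsto (h.continuousAt.mono_left nhdsWithin_le_nhds)]
  simp

theorem measurable_measure_Iio (ν : Measure ℝ) : Measurable fun s => ν (Set.Iio s) :=
  Monotone.measurable fun _ _ h => measure_mono (Set.Iio_subset_Iio h)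

/-- For a probability law this says that the last of m+1 observations is the largest with
probability 1/(m+1). The induction restricts ν to (-∞, s), hence finite measures; Fubini handles the
pairs u ≥ s, where absence of atoms identifies ν(-∞, u] with ν(-∞, u). -/
theorem lintegral_measure_Iio_pow (ν : Measure ℝ) [IsFiniteMeasure ν] [NullSingletonClass ν] (m : ℕ) :
    (m + 1) * ∫⁻ s, ν (Set.Iio s) ^ m ∂ν = ν Set.univ ^ (m + 1) := by
  induction m generalizing ν with
  | zero => simp
  | succ m ih =>
    have hF := measurable_measure_Iio ν
    have hIio : ∀ s, (m + 1) * ∫⁻ u in Set.Iio s, ν (Set.Iio u) ^ m ∂ν = ν (Set.Iio s) ^ (m + 1) := by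
      intro s
      have h := ih (ν.restrict (Set.Iio s))
      rw [Measure.restrict_apply_univ] at h
      rw [← h]
      congr 1
      refine setLIntegral_congr_fun measurableSet_Iio fun u hu => ?_
      rw [Measure.restrict_apply measurableSet_Iio,
        Set.inter_eq_self_of_subset_left (Set.Iio_subset_Iio (le_of_lt hu))]
    have hIci : ∫⁻ s, ∫⁻ u in Set.Ici s, ν (Set.Iio u) ^ m ∂ν ∂ν =
        ∫⁻ u, ν (Set.Iio u) ^ (m + 1) ∂ν := by
      have h1 : ∀ s, ∫⁻ u in Set.Ici s, ν (Set.Iio u) ^ m ∂ν =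
          ∫⁻ u, {p : ℝ × ℝ | p.1 ≤ p.2}.indicator (fun p => ν (Set.Iio p.2) ^ m) (s, u) ∂ν := by
        intro s
        rw [← lintegral_indicator measurableSet_Ici]
        rfl
      simp only [h1]
      rw [lintegral_lintegral_swap]
      · refine lintegral_congr fun u => ?_
        have h2 : ∀ s, {p : ℝ × ℝ | p.1 ≤ p.2}.indicator (fun p => ν (Set.Iio p.2) ^ m) (s, u) =
            (Set.Iic u).indicator (fun _ => ν (Set.Iio u) ^ m) s := fun s => rfl
        simp only [h2]
        rw [lintegral_indicator_const measurableSet_Iic, pow_succ,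
          measure_congr (Iio_ae_eq_Iic (μ := ν) (a := u))]
      · refine Measurable.aemeasurable ?_
        exact ((hF.comp measurable_snd).pow_const m).indicator
          (measurableSet_le measurable_fst measurable_snd)
    have hsplit : ν Set.univ * ∫⁻ u, ν (Set.Iio u) ^ m ∂ν =
        ∫⁻ s, ∫⁻ u in Set.Iio s, ν (Set.Iio u) ^ m ∂ν ∂ν +
          ∫⁻ u, ν (Set.Iio u) ^ (m + 1) ∂ν := by
      rw [← hIci, ← lintegral_add_left]
      · simp only [← Set.compl_Iio, lintegral_add_compl _ measurableSet_Iio]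
        rw [lintegral_const, mul_comm]
      · refine Monotone.measurable fun s t hst => lintegral_mono_set (Set.Iio_subset_Iio hst)
    have hfirst : (m + 1) * ∫⁻ s, ∫⁻ u in Set.Iio s, ν (Set.Iio u) ^ m ∂ν ∂ν =
        ∫⁻ u, ν (Set.Iio u) ^ (m + 1) ∂ν := by
      rw [← lintegral_const_mul' _ _ (by finiteness)]
      exact lintegral_congr hIio
    calc ((m + 1 : ℕ) + 1 : ENNReal) * ∫⁻ s, ν (Set.Iio s) ^ (m + 1) ∂ν
        = (m + 1) * (ν Set.univ * ∫⁻ u, ν (Set.Iio u) ^ m ∂ν) := by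
          rw [hsplit, mul_add, hfirst]; push_cast; ring
      _ = ν Set.univ * ((m + 1) * ∫⁻ u, ν (Set.Iio u) ^ m ∂ν) := by ring
      _ = ν Set.univ ^ (m + 1 + 1) := by rw [ih ν]; ring

theorem measurableSet_recordEvent {Ω : Type*} [MeasurableSpace Ω] {n : ℕ} {η : Fin n → Ω → ℝ}
    (hη : ∀ i, Measurable (η i)) (i : Fin n) : MeasurableSet (recordEvent η i) := by
  unfold recordEvent
  simp only [Set.ofPred_and, Set.ofPred_forall]
  refine MeasurableSet.inter (.const _) ?_
  exact .iInter fun j => .iInter fun _ => measurableSet_lt (hη j) (hη i)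

theorem measurable_numRecords {Ω : Type*} [MeasurableSpace Ω] {n : ℕ} {η : Fin n → Ω → ℝ}
    (hη : ∀ i, Measurable (η i)) : Measurable (numRecords η) :=
  Finset.measurable_fun_sum _ fun i _ =>
    measurable_const.indicator (measurableSet_recordEvent hη i)

/-- The number of records of a finite sequence of real numbers. -/
noncomputable def recordCount {n : ℕ} (x : Fin n → ℝ) : ℕ :=
  numRecords (fun i (y : Fin n → ℝ) => y i) x

theorem measurable_recordCount (n : ℕ) : Measurable (recordCount (n := n)) :=
  measurable_numRecords fun i => measurable_pi_apply i

theorem measurableSet_recordCount_mem (n : ℕ) (A : Set ℕ) :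
    MeasurableSet {x : Fin n → ℝ | recordCount x ∈ A} :=
  measurable_recordCount n (.of_discrete (s := A))

theorem numRecords_eq_recordCount {Ω : Type*} {n : ℕ} (η : Fin n → Ω → ℝ) (ω : Ω) :
    numRecords η ω = recordCount fun i => η i ω := rfl

theorem recordCount_succ {n : ℕ} (x : Fin (n + 2) → ℝ) :
    recordCount x = recordCount (fun j : Fin (n + 1) => x j.castSucc) +
      ({y : Fin (n + 2) → ℝ | ∀ j : Fin (n + 1), y j.castSucc < y (Fin.last _)}).indicator
        (fun _ => 1) x := by
  unfold recordCount numRecords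
  rw [Fin.sum_univ_castSucc]
  congr 1
  · refine Finset.sum_congr rfl fun i _ => ?_
    simp only [Set.indicator_apply, recordEvent, Set.mem_ofPred_eq, Fin.val_castSucc]
    congr 1
    refine propext (and_congr_right fun _ => ⟨fun h j hj => h j.castSucc hj, fun h j hj => ?_⟩)
    have hj' : j.val < i.val := hj
    exact h ⟨j, by omega⟩ hj
  · simp only [Set.indicator_apply, recordEvent, Set.mem_ofPred_eq]
    congr 1
    refine propext ⟨fun h j => h.2 _ (Fin.castSucc_lt_last j), fun h => ⟨by simp, fun j hj => ?_⟩⟩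
    exact h ⟨j, hj⟩

/-- Given that the last value is s and is a record, the earlier values follow the product of ν
restricted to (-∞, s). By induction their record count has a law free of s, so it is independent of
the last record event. -/
theorem pi_real_recordCount (ν : Measure ℝ) [IsFiniteMeasure ν] [NullSingletonClass ν] (m : ℕ) (A : Set ℕ) :
    (Measure.pi fun _ : Fin (m + 1) => ν).real {x | recordCount x ∈ A} =
      bernoulliExp (Finset.Icc 2 (m + 1)) (fun i => 1 / (i : ℝ)) (A.indicator fun _ => 1) *
        ν.real Set.univ ^ (m + 1) := by
  induction m generalizing ν A with
  | zero =>
    have h : ∀ x : Fin (0 + 1) → ℝ, recordCount x = 0 := fun x => by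
      simp [recordCount, numRecords, recordEvent]
    simp only [h]
    rw [show Finset.Icc 2 (0 + 1) = ∅ by rfl, bernoulliExp_empty]
    by_cases hA : 0 ∈ A
    · simp [hA, measureReal_def, Measure.pi_univ]
    · simp [hA]
  | succ m ih =>
    set w : Set ℕ → ℝ := fun A =>
      bernoulliExp (Finset.Icc 2 (m + 1)) (fun i => 1 / (i : ℝ)) (A.indicator fun _ => 1) with hw
    have hw0 : ∀ A, 0 ≤ w A := fun A => by
      refine bernoulliExp_nonneg (fun i _ => by positivity) (fun i hi => ?_) fun j =>
        Set.indicator_nonneg (fun _ _ => zero_le_one) _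
      have : (2 : ℝ) ≤ i := by exact_mod_cast (Finset.mem_Icc.1 hi).1
      rw [div_le_one (by linarith)]
      linarith
    set M := ν.real Set.univ with hM
    set π := Measure.pi fun _ : Fin (m + 1) => ν with hπ
    set J := ∫⁻ s, ν (Set.Iio s) ^ (m + 1) ∂ν with hJ
    have hJM : (m + 2) * J.toReal = M ^ (m + 2) := by
      have h := congrArg ENNReal.toReal (lintegral_measure_Iio_pow ν (m + 1))
      rw [ENNReal.toReal_mul, ENNReal.toReal_pow] at h
      rw [hM, measureReal_def, ← h, ← hJ]
      congr 1
      rw [ENNReal.toReal_add (by finiteness) (by finiteness)]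
      push_cast
      rw [ENNReal.toReal_add (by finiteness) (by finiteness)]
      simp; ring
    set D : Set (ℝ × (Fin (m + 1) → ℝ)) := {z | ∀ j, z.2 j < z.1} with hD
    set E : Set ℕ → Set (ℝ × (Fin (m + 1) → ℝ)) := fun A => {z | recordCount z.2 ∈ A} with hE
    have hDm : MeasurableSet D := by
      simp only [hD, Set.ofPred_forall]
      exact .iInter fun j => measurableSet_lt (by fun_prop) (by fun_prop)
    have hEm : ∀ A, MeasurableSet (E A) := fun A =>
      ((measurable_recordCount (m + 1)).comp measurable_snd) (.of_discrete (s := A))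
    have hED : ∀ A, (ν.prod π).real (E A ∩ D) = w A * J.toReal := by
      intro A
      rw [measureReal_def, Measure.prod_apply ((hEm A).inter hDm)]
      have h1 : ∀ s, π (Prod.mk s ⁻¹' (E A ∩ D)) =
          ENNReal.ofReal (w A) * ν (Set.Iio s) ^ (m + 1) := by
        intro s
        have h2 := ih (ν.restrict (Set.Iio s)) A
        rw [← Measure.restrict_pi_pi, ← hπ, measureReal_restrict_apply
          (measurableSet_recordCount_mem _ A),
          measureReal_restrict_apply_univ] at h2
        have h3 : Prod.mk s ⁻¹' (E A ∩ D) =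
            {x | recordCount x ∈ A} ∩ Set.univ.pi fun _ => Set.Iio s := by
          ext y; simp [hE, hD]
        rw [h3, ← ofReal_measureReal, h2, ENNReal.ofReal_mul (hw0 A),
          ENNReal.ofReal_pow measureReal_nonneg, ofReal_measureReal]
      simp only [h1]
      rw [lintegral_const_mul' _ _ ENNReal.ofReal_ne_top, ENNReal.toReal_mul,
        ENNReal.toReal_ofReal (hw0 A)]
    have hEA : ∀ A, (ν.prod π).real (E A) = w A * M ^ (m + 2) := by
      intro A
      have h1 : E A = Set.univ ×ˢ {x | recordCount x ∈ A} := by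
        ext z; simp [hE]
      rw [h1, measureReal_prod_prod, ih ν A]
      ring
    have hsplit : {x : Fin (m + 2) → ℝ | recordCount x ∈ A} =
        MeasurableEquiv.piFinSuccAbove (fun _ => ℝ) (Fin.last (m + 1)) ⁻¹'
          ((E {j | j + 1 ∈ A} ∩ D) ∪ (E A \ D)) := by
      ext x
      rw [Set.mem_ofPred_eq, recordCount_succ]
      have h1 : MeasurableEquiv.piFinSuccAbove (fun _ => ℝ) (Fin.last (m + 1)) x =
          (x (Fin.last _), fun j => x j.castSucc) := by
        ext <;> simp [Fin.insertNthEquiv, Fin.init]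
      rw [Set.mem_preimage, h1]
      by_cases h : ∀ j : Fin (m + 1), x j.castSucc < x (Fin.last _)
      · simp [hE, hD, h]
      · have h' : ¬ ∀ z : Fin (m + 1), x z.castSucc < x (Fin.last _) := h
        simp only [Set.indicator_apply, Set.mem_ofPred_eq, h', if_false, add_zero, hE, hD,
          Set.mem_union, Set.mem_inter_iff, Set.mem_sdiff, and_false, false_or, not_false_eq_true,
          and_true]
    have hrec : bernoulliExp (Finset.Icc 2 (m + 1 + 1)) (fun i => 1 / (i : ℝ))
        (A.indicator fun _ => 1) =
        (1 - 1 / ((m : ℝ) + 2)) * w A + 1 / ((m : ℝ) + 2) * w {j | j + 1 ∈ A} := by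
      rw [show Finset.Icc 2 (m + 1 + 1) = insert (m + 2) (Finset.Icc 2 (m + 1)) by
        ext i; simp only [Finset.mem_Icc, Finset.mem_insert]; omega,
        bernoulliExp_insert (by simp)]
      push_cast
      rfl
    rw [hsplit, (measurePreserving_piFinSuccAbove (fun _ : Fin (m + 1 + 1) => ν)
      (Fin.last (m + 1))).measureReal_preimage
        (((hEm _).inter hDm).union ((hEm A).diff hDm)).nullMeasurableSet,
      measureReal_union (Set.disjoint_left.2 fun z h1 h2 => h2.2 h1.2) ((hEm A).diff hDm),
      hrec]
    have h1 := measureReal_inter_add_sdiff (μ := ν.prod π) (s := E A) hDm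
    rw [hED, hEA] at h1
    have h2 := hED {j | j + 1 ∈ A}
    rw [hπ] at h1 h2
    rw [h2, eq_sub_of_add_eq' h1, ← hJM]
    field_simp
    ring

/-- Rényi's theorem: the number of records is distributed as a sum of independent Bernoulli
variables with success probabilities `1 / i`. -/
theorem real_le_numRecords {Ω : Type*} [MeasurableSpace Ω] (P : Measure Ω)
    [IsProbabilityMeasure P] {n : ℕ} (hn : n ≠ 0) (η : Fin n → Ω → ℝ)
    (hmeas : ∀ i, Measurable (η i)) (hindep : ProbabilityTheory.iIndepFun η P)
    (hident : ∀ i j, ProbabilityTheory.IdentDistrib (η i) (η j) P P)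
    (hcont : ∀ i, Continuous (fun t : ℝ => ProbabilityTheory.cdf (P.map (η i)) t)) (k : ℕ) :
    P.real {ω | k ≤ numRecords η ω} =
      bernoulliExp (Finset.Icc 2 n) (fun i => 1 / (i : ℝ)) (fun a => if k ≤ a then 1 else 0) := by
  obtain ⟨m, rfl⟩ := Nat.exists_eq_succ_of_ne_zero hn
  have : IsProbabilityMeasure (P.map (η 0)) :=
    Measure.isProbabilityMeasure_map (hmeas 0).aemeasurable
  have := nullSingletonClass_of_continuous_cdf _ (hcont 0)
  have hmap := (ProbabilityTheory.iIndepFun_iff_map_fun_eq_pi_map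
    fun i => (hmeas i).aemeasurable).1 hindep
  simp only [fun i => (hident i 0).map_eq] at hmap
  have h := pi_real_recordCount (P.map (η 0)) m {a | k ≤ a}
  rw [← hmap, map_measureReal_apply (measurable_pi_lambda _ hmeas)
    (measurableSet_recordCount_mem _ _)] at h
  have hind : ({a | k ≤ a} : Set ℕ).indicator (fun _ => (1 : ℝ)) =
      fun a => if k ≤ a then 1 else 0 := by
    funext a; simp [Set.indicator_apply]
  rw [hind] at h
  simpa [numRecords_eq_recordCount] using h

end Renyi

/-! ### Harmonic sums and numerical constants. -/

section RecordMean

theorem recordMean_eq (n : ℕ) : (recordMean n : ℝ) = ∑ i ∈ Finset.Icc 2 n, 1 / (i : ℝ) := by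
  simp [recordMean]

theorem Icc_two_succ (m : ℕ) :
    Finset.Icc 2 (m + 1 + 1) = insert (m + 2) (Finset.Icc 2 (m + 1)) := by
  ext i; simp only [Finset.mem_Icc, Finset.mem_insert]; omega

theorem recordMean_eq_harmonic {n : ℕ} (hn : n ≠ 0) : (recordMean n : ℝ) = harmonic n - 1 := by
  obtain ⟨m, rfl⟩ := Nat.exists_eq_succ_of_ne_zero hn
  rw [recordMean_eq, Nat.succ_eq_add_one]
  induction m with
  | zero => simp
  | succ m ih =>
    rw [Icc_two_succ, Finset.sum_insert (by simp), ih (by simp), harmonic_succ (m + 1)]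
    push_cast; ring

theorem recordMean_le_log {n : ℕ} (hn : n ≠ 0) : (recordMean n : ℝ) ≤ Real.log n := by
  have := harmonic_le_one_add_log n
  rw [recordMean_eq_harmonic hn]
  linarith

theorem log_add_eulerMascheroni_lt_recordMean {n : ℕ} (hn : n ≠ 0) :
    Real.log n + Real.eulerMascheroniConstant - 1 < recordMean n := by
  have h := Real.eulerMascheroniConstant_lt_eulerMascheroniSeq' n
  rw [Real.eulerMascheroniSeq', if_neg hn] at h
  rw [recordMean_eq_harmonic hn]
  linarith

theorem prod_one_sub_inv {n : ℕ} (hn : n ≠ 0) :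
    ∏ i ∈ Finset.Icc 2 n, (1 - 1 / (i : ℝ)) = 1 / n := by
  obtain ⟨m, rfl⟩ := Nat.exists_eq_succ_of_ne_zero hn
  rw [Nat.succ_eq_add_one]
  induction m with
  | zero => simp
  | succ m ih =>
    rw [Icc_two_succ, Finset.prod_insert (by simp), ih (by simp)]
    push_cast
    field_simp
    ring

/-- The odds of 1/i are 1/(i-1), so the sum is the harmonic number H_{n-1}. -/
theorem sum_inv_odds {n : ℕ} (hn : n ≠ 0) :
    ∑ i ∈ Finset.Icc 2 n, 1 / (i : ℝ) / (1 - 1 / (i : ℝ)) = recordMean n + 1 - 1 / n := by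
  obtain ⟨m, rfl⟩ := Nat.exists_eq_succ_of_ne_zero hn
  rw [Nat.succ_eq_add_one, recordMean_eq]
  induction m with
  | zero => simp
  | succ m ih =>
    rw [Icc_two_succ, Finset.sum_insert (by simp), ih (by simp), Finset.sum_insert (by simp)]
    have h : (1 : ℝ) - 1 / (m + 2 : ℕ) = (m + 1) / (m + 2) := by
      push_cast; field_simp; ring
    rw [h]
    push_cast
    field_simp
    ring

theorem sum_inv_sq_odds {n : ℕ} (hn : n ≠ 0) :
    ∑ i ∈ Finset.Icc 2 n, (1 / (i : ℝ)) ^ 2 / (1 - 1 / (i : ℝ)) = 1 - 1 / (n : ℝ) := by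
  obtain ⟨m, rfl⟩ := Nat.exists_eq_succ_of_ne_zero hn
  rw [Nat.succ_eq_add_one]
  induction m with
  | zero => simp
  | succ m ih =>
    rw [Icc_two_succ, Finset.sum_insert (by simp), ih (by simp)]
    have h : (1 : ℝ) - 1 / (m + 2 : ℕ) = (m + 1) / (m + 2) := by
      push_cast; field_simp; ring
    rw [h]
    push_cast
    field_simp
    ring

theorem lt_eulerMascheroniConstant : 0.56 < Real.eulerMascheroniConstant := by
  refine lt_trans ?_ (Real.eulerMascheroniSeq_lt_eulerMascheroniConstant 31)
  -- The index 31 makes the logarithm that of 2^5, so a numerical bound for log 2 suffices.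
  have h1 : Real.log ((31 : ℕ) + 1) = 5 * Real.log 2 := by
    rw [← Real.log_rpow (by norm_num)]; norm_num
  have h2 := Real.log_two_lt_d9
  rw [Real.eulerMascheroniSeq, h1]
  have h3 : (harmonic 31 : ℝ) > 4.027 := by
    rw [harmonic]
    norm_num [Finset.sum_range_succ]
  linarith

theorem log_add_eulerMascheroni_sub_pos {n : ℕ} (hn : 3 ≤ n) :
    0 < Real.log n + Real.eulerMascheroniConstant - Real.pi ^ 2 / 6 := by
  have h1 : Real.log 3 ≤ Real.log n :=
    Real.log_le_log (by norm_num) (by exact_mod_cast hn)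
  have h2 : 11 * Real.log 2 < 7 * Real.log 3 := by
    have h : Real.log ((2 : ℝ) ^ 11) < Real.log ((3 : ℝ) ^ 7) :=
      Real.log_lt_log (by norm_num) (by norm_num)
    rw [Real.log_pow, Real.log_pow] at h
    exact_mod_cast h
  have h3 := Real.log_two_gt_d9
  have h4 := lt_eulerMascheroniConstant
  have h5 : Real.pi ^ 2 < 3.1416 ^ 2 :=
    pow_lt_pow_left₀ Real.pi_lt_d4 Real.pi_pos.le two_ne_zero
  linarith

/-- The number 8 separates e², the cost of comparing with Poisson weights, from the stated constant.
-/
theorem eight_lt_constant :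
    8 < 2 * Real.exp (13 / 12) * Real.sqrt (2 * Real.pi) * (Real.pi ^ 2 / 6 - 1) := by
  have h1 : 2.7 < Real.exp (13 / 12) := by
    have := Real.exp_one_gt_d9
    have := Real.exp_lt_exp.2 (by norm_num : (1 : ℝ) < 13 / 12)
    linarith
  have h2 : 2.5 < Real.sqrt (2 * Real.pi) := by
    have := Real.pi_gt_d2
    exact Real.lt_sqrt_of_sq_lt (by linarith)
  have h3 : 3.14 ^ 2 < Real.pi ^ 2 :=
    pow_lt_pow_left₀ Real.pi_gt_d2 (by norm_num) two_ne_zero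
  calc (8 : ℝ) < 2 * 2.7 * 2.5 * (3.14 ^ 2 / 6 - 1) := by norm_num
    _ < _ := by gcongr

theorem poissonMeasure_real_Ici (r : NNReal) (k : ℕ) :
    (ProbabilityTheory.poissonMeasure r).real {j : ℕ | k ≤ j} = poissonTail r k := by
  have h : {j : ℕ | k ≤ j} = ((Finset.range k : Finset ℕ) : Set ℕ)ᶜ := by
    ext j; simp
  rw [h, MeasureTheory.probReal_compl_eq_one_sub .of_discrete,
    ← MeasureTheory.sum_measureReal_singleton, poissonTail]
  simp only [ProbabilityTheory.poissonMeasure_real_singleton, poissonWeight_natCast]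

end RecordMean

/-! ### Domination by Poisson weights and conclusion. -/

/-- The product is 1/n ≤ e^{-λ} because λ ≤ ln n, and the odds sum is at most λ + 1 ≤ λ e^{1/λ},
whose j-th power costs e^{j/λ} ≤ e². -/
theorem inv_mul_odds_pow_le {n : ℕ} (hn : 2 ≤ n) {j : ℕ} (hj : (j : ℝ) ≤ 2 * recordMean n) :
    (∏ i ∈ Finset.Icc 2 n, (1 - 1 / (i : ℝ))) *
      ((∑ i ∈ Finset.Icc 2 n, 1 / (i : ℝ) / (1 - 1 / (i : ℝ))) ^ j / j.factorial) ≤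
      Real.exp 2 * poissonWeight (recordMean n) j := by
  have hn0 : n ≠ 0 := by omega
  have hn' : (0 : ℝ) < n := by exact_mod_cast Nat.pos_of_ne_zero hn0
  have hlog := recordMean_le_log hn0
  rw [prod_one_sub_inv hn0, sum_inv_odds hn0, poissonWeight_natCast]
  have hlam : (0 : ℝ) < recordMean n := by
    rw [recordMean_eq]
    refine Finset.sum_pos (fun i hi => ?_) ⟨2, Finset.mem_Icc.2 ⟨le_rfl, hn⟩⟩
    have := (Finset.mem_Icc.1 hi).1
    positivity
  set lam : ℝ := NNReal.toReal (recordMean n)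
  have h1 : 1 / (n : ℝ) ≤ Real.exp (-lam) := by
    rw [Real.exp_neg, one_div]
    exact inv_anti₀ (Real.exp_pos _) ((Real.le_log_iff_exp_le hn').1 hlog)
  have h5 : 0 ≤ lam + 1 - 1 / n := by
    have : 1 / (n : ℝ) ≤ 1 := by
      rw [div_le_one hn']; exact_mod_cast Nat.one_le_iff_ne_zero.2 hn0
    linarith
  have h2 : (lam + 1 - 1 / n) ^ j ≤ Real.exp 2 * lam ^ j := by
    have h3 : lam + 1 - 1 / n ≤ lam * Real.exp (1 / lam) := by
      have h4 := mul_le_mul_of_nonneg_left (Real.add_one_le_exp (1 / lam)) hlam.le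
      rw [mul_add, mul_one_div_cancel hlam.ne'] at h4
      have : 0 < 1 / (n : ℝ) := by positivity
      linarith
    calc (lam + 1 - 1 / n) ^ j ≤ (lam * Real.exp (1 / lam)) ^ j := by gcongr
      _ = Real.exp (j * (1 / lam)) * lam ^ j := by rw [mul_pow, Real.exp_nat_mul]; ring
      _ ≤ Real.exp 2 * lam ^ j := by
        gcongr
        rw [mul_one_div, div_le_iff₀ hlam]
        exact hj
  calc 1 / (n : ℝ) * ((lam + 1 - 1 / n) ^ j / j.factorial)
      ≤ Real.exp (-lam) * ((Real.exp 2 * lam ^ j) / j.factorial) := by gcongr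
    _ = _ := by ring

theorem exp_two_mul_lt {lam r c x : ℝ} (hr0 : 0 < r) (hr : r ≤ lam) (hc : 8 < c) :
    Real.exp 2 * ((x ^ 2 * lam / 2 + lam) / lam ^ 2) < c / r * (x ^ 2 + 1) := by
  have hlam0 : 0 < lam := hr0.trans_le hr
  have he : Real.exp 2 < 8 := by
    have h1 := Real.exp_one_lt_d9
    have h2 : Real.exp 2 = Real.exp 1 ^ 2 := by rw [← Real.exp_nat_mul]; norm_num
    have h3 : Real.exp 1 ^ 2 < 2.8 ^ 2 :=
      pow_lt_pow_left₀ (by linarith) (Real.exp_pos 1).le two_ne_zero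
    rw [h2]
    linarith
  have h1 : (x ^ 2 * lam / 2 + lam) / lam ^ 2 = (x ^ 2 / 2 + 1) / lam := by field_simp
  have h2 : (x ^ 2 / 2 + 1) / lam ≤ (x ^ 2 + 1) / r :=
    div_le_div₀ (by positivity) (by linarith [sq_nonneg x]) hr0 hr
  rw [h1]
  calc Real.exp 2 * ((x ^ 2 / 2 + 1) / lam)
      ≤ Real.exp 2 * ((x ^ 2 + 1) / r) := by gcongr
    _ < c * ((x ^ 2 + 1) / r) :=
        mul_lt_mul_of_pos_right (he.trans hc) (div_pos (by positivity) hr0)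
    _ = _ := by ring

theorem mainTheorem8 {Ω : Type*} [MeasurableSpace Ω]
    (P : MeasureTheory.Measure Ω) [MeasureTheory.IsProbabilityMeasure P]
    (n : ℕ) (hn : 3 ≤ n) (η : Fin n → Ω → ℝ)
    (hmeas : ∀ i, Measurable (η i))
    (hindep : ProbabilityTheory.iIndepFun η P)
    (hident : ∀ i j, ProbabilityTheory.IdentDistrib (η i) (η j) P P)
    (hcont : ∀ i, Continuous (fun t : ℝ => ProbabilityTheory.cdf (P.map (η i)) t))
    (k : ℤ) (x : ℝ)
    (hx : x = ((k : ℝ) - (recordMean n : ℝ)) / Real.sqrt (recordMean n : ℝ))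
    (hx1 : 1 ≤ x) :
    P.real {ω | k ≤ (numRecords η ω : ℤ)} /
          (ProbabilityTheory.poissonMeasure (recordMean n)).real {j : ℕ | k ≤ (j : ℤ)} - 1 < 0 ∧
      -(2 * Real.exp (13 / 12) * Real.sqrt (2 * Real.pi) * (Real.pi ^ 2 / 6 - 1) /
            Real.sqrt ((Real.log (n : ℝ) + Real.eulerMascheroniConstant - 1) *
              (Real.log (n : ℝ) + Real.eulerMascheroniConstant - Real.pi ^ 2 / 6))) *
          (x ^ 2 + 1 +
            4 * x / Real.sqrt (Real.log (n : ℝ) + Real.eulerMascheroniConstant - 1)) <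
        P.real {ω | k ≤ (numRecords η ω : ℤ)} /
          (ProbabilityTheory.poissonMeasure (recordMean n)).real {j : ℕ | k ≤ (j : ℤ)} - 1 := by
  have hn0 : n ≠ 0 := by omega
  have hmean := recordMean_eq n
  have ha_lt := log_add_eulerMascheroni_lt_recordMean hn0
  have hb := log_add_eulerMascheroni_sub_pos hn
  have hp0 : ∀ i ∈ Finset.Icc 2 n, 0 < 1 / (i : ℝ) := fun i hi => by
    have := (Finset.mem_Icc.1 hi).1
    positivity
  have hp1 : ∀ i ∈ Finset.Icc 2 n, 1 / (i : ℝ) < 1 := fun i hi => by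
    have : (2 : ℝ) ≤ i := by exact_mod_cast (Finset.mem_Icc.1 hi).1
    rw [div_lt_one (by linarith)]
    linarith
  have hI : (Finset.Icc 2 n).Nonempty := ⟨2, Finset.mem_Icc.2 ⟨le_rfl, by omega⟩⟩
  have hlam3 : (5 / 6 : ℝ) ≤ recordMean n := by
    rw [hmean]
    calc (5 / 6 : ℝ) = ∑ i ∈ Finset.Icc (2 : ℕ) 3, 1 / (i : ℝ) := by
          rw [show Finset.Icc 2 3 = {2, 3} by rfl]; norm_num
      _ ≤ _ := Finset.sum_le_sum_of_subset_of_nonneg (Finset.Icc_subset_Icc_right hn)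
          fun i _ _ => by positivity
  have hlam4 : n = 3 ∧ (recordMean n : ℝ) = 5 / 6 ∨ 1 < (recordMean n : ℝ) := by
    rcases hn.eq_or_lt with h | h
    · refine Or.inl ⟨h.symm, ?_⟩
      rw [hmean, ← h, show Finset.Icc 2 3 = {2, 3} by rfl]; norm_num
    · right
      rw [hmean]
      calc (1 : ℝ) < ∑ i ∈ Finset.Icc (2 : ℕ) 4, 1 / (i : ℝ) := by
            rw [show Finset.Icc 2 4 = {2, 3, 4} by rfl]; norm_num
        _ ≤ _ := Finset.sum_le_sum_of_subset_of_nonneg (Finset.Icc_subset_Icc_right h)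
            fun i _ _ => by positivity
  set lam : ℝ := NNReal.toReal (recordMean n) with hlam
  have hlam0 : 0 < lam := by linarith
  have hsqrt0 : 0 < Real.sqrt lam := Real.sqrt_pos.2 hlam0
  have hsq : Real.sqrt lam ^ 2 = lam := Real.sq_sqrt hlam0.le
  have hkx : (k : ℝ) - lam = x * Real.sqrt lam := by
    rw [hx]; field_simp
  have hkge : lam + Real.sqrt lam ≤ k := by
    have := mul_le_mul_of_nonneg_right hx1 hsqrt0.le
    linarith
  have hk2 : 2 ≤ k := by
    have h1 : 0.9 < Real.sqrt lam := Real.lt_sqrt_of_sq_lt (by linarith)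
    have h2 : (1 : ℝ) < k := by linarith
    have : (1 : ℤ) < k := by exact_mod_cast h2
    omega
  -- If λ > 1, then √λ > 1 and k ≥ λ + √λ suffices. Only n = 3 has λ < 1, and there the integrality
  -- of k gives k ≥ 2.
  have hk1 : lam < k - 1 := by
    rcases hlam4 with ⟨-, h⟩ | h
    · have : (2 : ℝ) ≤ k := by exact_mod_cast hk2
      linarith
    · have h1 : 1 < Real.sqrt lam := Real.lt_sqrt_of_sq_lt (by linarith)
      linarith
  lift k to ℕ using by omega
  simp only [Int.cast_natCast, Nat.cast_le] at *
  have hk2' : 2 ≤ k := by exact_mod_cast hk2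
  rw [real_le_numRecords P hn0 η hmeas hindep hident hcont k, poissonMeasure_real_Ici, ← hlam]
  have hQ := poissonTail_pos hlam0 k
  refine ⟨?_, ?_⟩
  · rw [sub_neg, div_lt_one hQ, hmean]
    exact bernoulliExp_tail_lt_poissonTail hI hp0 hp1 hk2' (hmean ▸ hk1)
  set B := bernoulliExp (Finset.Icc 2 n) (fun i => 1 / (i : ℝ)) (fun a => if k ≤ a then 1 else 0)
  have hB0 : 0 ≤ B := bernoulliExp_nonneg (fun i hi => (hp0 i hi).le)
    (fun i hi => (hp1 i hi).le) fun j => by split_ifs <;> norm_num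
  have hc := eight_lt_constant
  set c := 2 * Real.exp (13 / 12) * Real.sqrt (2 * Real.pi) * (Real.pi ^ 2 / 6 - 1)
  have hpi : 1 ≤ Real.pi ^ 2 / 6 := by
    have : 3 ^ 2 < Real.pi ^ 2 := pow_lt_pow_left₀ Real.pi_gt_three (by norm_num) two_ne_zero
    linarith
  set a := Real.log n + Real.eulerMascheroniConstant - 1
  set b := Real.log n + Real.eulerMascheroniConstant - Real.pi ^ 2 / 6
  have hba : b ≤ a := by simp only [a, b]; linarith
  have ha : 0 < a := hb.trans_le hba
  set r := Real.sqrt (a * b)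
  have hr0 : 0 < r := Real.sqrt_pos.2 (mul_pos ha hb)
  have hr : r < lam := by
    refine lt_of_le_of_lt ?_ ha_lt
    exact Real.sqrt_le_iff.2 ⟨ha.le, by nlinarith⟩
  have hy : 0 ≤ 4 * x / Real.sqrt a := by positivity
  set y := 4 * x / Real.sqrt a
  have hcr : 0 < c / r := by positivity
  have hmain : c / r * (x ^ 2 + 1) ≤ c / r * (x ^ 2 + 1 + y) := by
    exact mul_le_mul_of_nonneg_left (by linarith) hcr.le
  rw [neg_mul]
  by_cases hbig : 1 < c / r * (x ^ 2 + 1 + y)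
  · have : 0 ≤ B / poissonTail lam k := by positivity
    linarith
  -- In the remaining case c(x² + 1) ≤ r < λ with c > 8, which forces x ≤ √λ and so k ≤ 2λ, the
  -- range where the Poisson domination holds.
  have hxr : x ^ 2 ≤ lam := by
    have h1 : c / r * (x ^ 2 + 1) ≤ 1 := hmain.trans (not_lt.1 hbig)
    rw [div_mul_eq_mul_div, div_le_one hr0] at h1
    nlinarith
  have hk2lam : (k : ℝ) ≤ 2 * lam := by
    have h1 : x ≤ Real.sqrt lam := Real.le_sqrt_of_sq_le hxr
    nlinarith
  have hlow := poissonTail_sub_bernoulliExp_le hI hp0 hp1 hmean.symm (k := k) (by omega)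
    (C := Real.exp 2) (fun j hj => inv_mul_odds_pow_le (by omega) (by
      have : (j : ℝ) ≤ k := by exact_mod_cast (by omega : j ≤ k)
      linarith)) (Real.exp_pos 2).le
  rw [sum_inv_sq_odds hn0, max_eq_left (by rw [hkx]; positivity), hkx, mul_pow, hsq] at hlow
  have hfinal := exp_two_mul_lt (x := x) hr0 hr.le hc
  have hinv : 1 - 1 / (n : ℝ) ≤ 1 := sub_le_self _ (by positivity)
  have hratio : 1 - B / poissonTail lam k ≤
      1 * (Real.exp 2 * ((x ^ 2 * lam / 2 + lam) / lam ^ 2)) := by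
    rw [one_sub_div hQ.ne', div_le_iff₀ hQ, mul_comm]
    refine hlow.trans ?_
    gcongr
  linarith
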